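/- For complex $q$ with $|q|<1$ write $(x;q)_\infty=\prod_{j\ge 0}(1-xq^j)$ and $(x_1,\dots,x_m;q)_\infty=\prod_i (x_i;q)_\infty$; exponents $\pm1$, $\pm2$ mean that the product over all (independent) choices of the signs is taken, e.g. $(xv^{\pm1}z^{\pm1};q)_\infty=(xvz,xvz^{-1},xv^{-1}z,xv^{-1}z^{-1};q)_\infty$. Let $\mathbb T$ be the positively oriented unit circle. Let $q,a,v$ be non-zero complex numbers (in the physical notation $a=q^{1-h}$, where $h$ is the $R$-charge parameter) with $|q|<1$, $|a v^{\pm2}|<1$ and $|q v^{\pm2}/a|<1$ (if $|v|=1$, the latter conditions say $|q|<|a|<1$). Let $q^{1/2}$ and $a^{1/2}$ be any square roots of $q$ and $a$. The index of the $U(1)$, $N_f=2$ theory with restricted chemical potentials ($u=v$, $w=1$) is $$I_{e,N_f=2;h}=\sum_{k\in\mathbb Z}a^{|k|}\int_{\mathbb T}\frac{(a^{1/2}q^{1/2+|k|/2}v^{\pm1}z^{\pm1};q)_\infty}{(a^{-1/2}q^{1/2+|k|/2}v^{\pm1}z^{\pm1};q)_\infty}\,\frac{dz}{2\pi \mathrm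 i z},$$ and the index of its mirror theory is $$I_{m,N_f=2;h}=\frac{(av^{\pm2};q)_\infty}{(qv^{\pm2}/a;q)_\infty}\sum_{k\in\mathbb Z}(q/a)^{|k|}\int_{\mathbb T}\frac{(a^{-1/2}q^{1+|k|/2}v^{\pm1}z^{\pm1};q)_\infty}{(a^{1/2}q^{|k|/2}v^{\pm1}z^{\pm1};q)_\infty}\,\frac{dz}{2\pi \mathrm i z}.$$ Then the denominators of all integrands have no zeros on $\mathbb T$ and that of the prefactor is non-zero, all the integrals exist, both series over $k$ converge absolutely, and $$I_{e,N_f=2;h}=I_{m,N_f=2;h}.$$ -/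

import Mathlib

open scoped Real

noncomputable section

/-- The infinite `q`-shifted factorial `(x; q)_∞ = ∏_{j ≥ 0} (1 - x q^j)`, for `|q| < 1`. -/
def qPoch (x q : ℂ) : ℂ := ∏' j : ℕ, (1 - x * q ^ j)

/-- For `|q| < 1` the product defining `(x; q)_∞` converges. -/
theorem qPoch_multipliable (x : ℂ) {q : ℂ} (hq : ‖q‖ < 1) :
    Multipliable fun j : ℕ => (1 - x * q ^ j) := by
  have h : Summable fun j : ℕ => ‖-(x * q ^ j)‖ := by
    have h1 : Summable fun j : ℕ => ‖x‖ * ‖q‖ ^ j :=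
      (summable_geometric_of_lt_one (norm_nonneg q) hq).mul_left _
    simpa [norm_mul, norm_pow] using h1
  have h2 := multipliable_one_add_of_summable h
  simpa [sub_eq_add_neg] using h2

/-- `(x v^{±1} z^{±1}; q)_∞`: the product over the four independent choices of signs. -/
def qPoch4 (x v z q : ℂ) : ℂ :=
  qPoch (x * v * z) q * qPoch (x * v * z⁻¹) q *
    qPoch (x * v⁻¹ * z) q * qPoch (x * v⁻¹ * z⁻¹) q

/-- `(x v^{±2}; q)_∞`: the product over the two choices of sign. -/
def qPoch2 (x v q : ℂ) : ℂ := qPoch (x * v ^ 2) q * qPoch (x * (v ^ 2)⁻¹) q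

/-- `∫_𝕋 F(z) dz / (2 π i z)` over the positively oriented unit circle. -/
def torusIntegral1 (F : ℂ → ℂ) : ℂ :=
  (2 * (π : ℂ) * Complex.I)⁻¹ * ∮ z in C(0, 1), F z / z

/-- The integrand of the electric index in the flux sector `k`. Here `r` is the square root
`q^{1/2}` and `s` the square root `a^{1/2}`, so that `q^{1/2 + |k|/2} = r^{1 + |k|}`. -/
def electricIntegrand (q r s v : ℂ) (k : ℤ) (z : ℂ) : ℂ :=
  qPoch4 (s * r ^ (1 + k.natAbs)) v z q / qPoch4 (s⁻¹ * r ^ (1 + k.natAbs)) v z q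

/-- The summand with index `k` of the electric index (with `r = q^{1/2}`, `s = a^{1/2}`). -/
def electricTerm (q a r s v : ℂ) (k : ℤ) : ℂ :=
  a ^ k.natAbs * torusIntegral1 (electricIntegrand q r s v k)

/-- The restricted electric index of the `U(1)` theory with two flavours. -/
def electricIndex (q a r s v : ℂ) : ℂ := ∑' k : ℤ, electricTerm q a r s v k

/-- The integrand of the mirror index in the flux sector `k` (with `r = q^{1/2}`,
`s = a^{1/2}`, so that `q^{1 + |k|/2} = r^{2 + |k|}` and `q^{|k|/2} = r^{|k|}`). -/
def mirrorIntegrand (q r s v : ℂ) (k : ℤ) (z : ℂ) : ℂ :=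
  qPoch4 (s⁻¹ * r ^ (2 + k.natAbs)) v z q / qPoch4 (s * r ^ k.natAbs) v z q

/-- The summand with index `k` of the sum in the mirror index (with `r = q^{1/2}`,
`s = a^{1/2}`). -/
def mirrorTerm (q a r s v : ℂ) (k : ℤ) : ℂ :=
  (q / a) ^ k.natAbs * torusIntegral1 (mirrorIntegrand q r s v k)

/-- The restricted index of the mirror theory:
the prefactor `(a v^{±2}; q)_∞ / (q v^{±2} / a; q)_∞` times the sum over the fluxes. -/
def mirrorIndex (q a r s v : ℂ) : ℂ :=
  qPoch2 a v q / qPoch2 (q / a) v q * ∑' k : ℤ, mirrorTerm q a r s v k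

end

noncomputable section

open Filter Topology

/-! Put `b = q / a`; the hypotheses force `|a|, |b| < 1`. In flux sector `k` the electric integrand
is a product of two generating functions of Rogers polynomials `C_N`, at `τ z` and `τ / z` with `τ²
= b q^|k|`. Its constant term is therefore `∑ C_N² (b q^|k|)^N`, which gives `sectorSum`
(`electricTerm_eq_sectorSum`). The mirror integrand is the electric one with `a` and `b` exchanged,
so the claim is a symmetry in `a ↔ b`, up to the prefactors.

For `v² ≠ 1` the sum over sectors factorizes. The `q`-binomial theorem and a partial fraction
expansion write `C_N` as a combination of the powers `(q^l v^{±1})^N` (`rogers_eq_half_add_half`).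
Doing this to one factor of `C_N²` and summing over `N` with the generating function turns sector
`k` into two sums `∑_l E_l E_{l+|k|}`, one for each sign (`hasSum_rogers_sq`). Summing over `k ∈ ℤ`
completes each to the square `(∑ E_j)²` (`tsum_sectorSum_eq`). The series `∑ E_j` is symmetric in `a
↔ b` up to explicit factors by a Heine–Euler transformation (`tsum_blockTerm_symm`), and these
factors combine with `blockFactor` to give exactly the prefactors.

At `v² = 1` the two pieces are singular, but both sides of the identity are continuous in `v`, so
the case follows by a limit. -/

/-! ### Finite and infinite `q`-shifted factorials. -/

theorem qPoch_eq_one_sub_mul {q : ℂ} (hq : ‖q‖ < 1) (x : ℂ) :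
    qPoch x q = (1 - x) * qPoch (x * q) q := by
  have h : ∀ j : ℕ, 1 - x * q ^ (j + 1) = 1 - x * q * q ^ j := fun j => by ring
  unfold qPoch
  rw [tprod_eq_zero_mul' (by simpa only [h] using qPoch_multipliable (x * q) hq)]
  simp only [h, pow_zero, mul_one]

theorem qPoch_ne_zero {q : ℂ} (hq : ‖q‖ < 1) {x : ℂ} (hx : ∀ j : ℕ, 1 - x * q ^ j ≠ 0) :
    qPoch x q ≠ 0 := by
  have h1 : Summable fun j : ℕ => ‖-(x * q ^ j)‖ := by
    simpa [norm_mul, norm_pow] using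
      (summable_geometric_of_lt_one (norm_nonneg q) hq).mul_left ‖x‖
  have h2 := tprod_one_add_ne_zero_of_summable (f := fun j : ℕ => -(x * q ^ j))
    (fun j => by simpa [← sub_eq_add_neg] using hx j) h1
  simpa only [qPoch, sub_eq_add_neg] using h2

theorem one_sub_ne_zero_of_norm_lt_one {y : ℂ} (hy : ‖y‖ < 1) : 1 - y ≠ 0 := by
  intro h
  rw [← sub_eq_zero.mp h] at hy
  simp at hy

theorem norm_mul_pow_lt_one {q : ℂ} (hq : ‖q‖ < 1) {x : ℂ} (hx : ‖x‖ < 1) (j : ℕ) :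
    ‖x * q ^ j‖ < 1 := by
  rw [norm_mul, norm_pow]
  exact mul_lt_one_of_nonneg_of_lt_one_left (norm_nonneg _) hx
    (pow_le_one₀ (norm_nonneg _) hq.le)

theorem qPoch_ne_zero_of_norm_lt_one {q : ℂ} (hq : ‖q‖ < 1) {x : ℂ} (hx : ‖x‖ < 1) :
    qPoch x q ≠ 0 :=
  qPoch_ne_zero hq fun j => one_sub_ne_zero_of_norm_lt_one (norm_mul_pow_lt_one hq hx j)

theorem qPoch_eq_prod_mul {q : ℂ} (hq : ‖q‖ < 1) (x : ℂ) (n : ℕ) :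
    qPoch x q = (∏ i ∈ Finset.range n, (1 - x * q ^ i)) * qPoch (x * q ^ n) q := by
  induction n with
  | zero => simp
  | succ n ih =>
    rw [ih, qPoch_eq_one_sub_mul hq (x * q ^ n), Finset.prod_range_succ]
    ring_nf

/-- The ratio `(a; q)_n / (q; q)_n` of finite `q`-shifted factorials. -/
def qCoeff (q a : ℂ) (n : ℕ) : ℂ := ∏ i ∈ Finset.range n, (1 - a * q ^ i) / (1 - q ^ (i + 1))

@[simp] theorem qCoeff_zero (q a : ℂ) : qCoeff q a 0 = 1 := by simp [qCoeff]

theorem qCoeff_succ (q a : ℂ) (n : ℕ) :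
    qCoeff q a (n + 1) = qCoeff q a n * ((1 - a * q ^ n) / (1 - q ^ (n + 1))) := by
  rw [qCoeff, Finset.prod_range_succ, ← qCoeff]

theorem one_sub_pow_succ_ne_zero {q : ℂ} (hq : ‖q‖ < 1) (n : ℕ) : 1 - q ^ (n + 1) ≠ 0 :=
  one_sub_ne_zero_of_norm_lt_one (by
    rw [norm_pow]; exact pow_lt_one₀ (norm_nonneg _) hq (by simp))

theorem qCoeff_succ_mul {q : ℂ} (hq : ‖q‖ < 1) (a : ℂ) (n : ℕ) :
    qCoeff q a (n + 1) * (1 - q ^ (n + 1)) = qCoeff q a n * (1 - a * q ^ n) := by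
  have := one_sub_pow_succ_ne_zero hq n
  rw [qCoeff_succ]
  field_simp

theorem qCoeff_eq {q : ℂ} (hq : ‖q‖ < 1) {a : ℂ} (ha : ‖a‖ < 1) (n : ℕ) :
    qCoeff q a n = qPoch a q / qPoch q q * (qPoch (q ^ (n + 1)) q / qPoch (a * q ^ n) q) := by
  have h1 := qPoch_eq_prod_mul hq a n
  have h2 := qPoch_eq_prod_mul hq q n
  have h3 : qPoch (a * q ^ n) q ≠ 0 :=
    qPoch_ne_zero_of_norm_lt_one hq (norm_mul_pow_lt_one hq ha n)
  have h4 := qPoch_ne_zero_of_norm_lt_one hq hq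
  have h5 : qPoch (q * q ^ n) q ≠ 0 :=
    qPoch_ne_zero_of_norm_lt_one hq (norm_mul_pow_lt_one hq hq n)
  have h6 : ∏ i ∈ Finset.range n, (1 - q * q ^ i) ≠ 0 := fun h => by simp [h] at h2; exact h4 h2
  have h7 : ∀ i, 1 - q ^ (i + 1) = 1 - q * q ^ i := fun i => by ring
  rw [qCoeff, Finset.prod_div_distrib, pow_succ' q n]
  simp only [h7]
  rw [h1, h2]
  field_simp

/-! ### The `q`-binomial theorem. -/

theorem tendsto_pow_zero {q : ℂ} (hq : ‖q‖ < 1) : Tendsto (fun n : ℕ => q ^ n) atTop (𝓝 0) :=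
  tendsto_pow_atTop_nhds_zero_of_norm_lt_one hq

theorem summable_norm_qCoeff_mul_pow {q : ℂ} (hq : ‖q‖ < 1) (a : ℂ) {y : ℂ} (hy : ‖y‖ < 1) :
    Summable fun n => ‖qCoeff q a n * y ^ n‖ := by
  obtain ⟨r, hyr, hr⟩ := exists_between hy
  refine summable_of_ratio_norm_eventually_le hr ?_
  have h1 : Tendsto (fun n : ℕ => ‖(1 - a * q ^ n) / (1 - q ^ (n + 1)) * y‖) atTop (𝓝 ‖y‖) := by
    have h2 := tendsto_pow_zero hq
    have h3 := (tendsto_add_atTop_iff_nat 1).mpr h2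
    have h4 : Tendsto (fun n : ℕ => (1 - a * q ^ n) / (1 - q ^ (n + 1)) * y) atTop
        (𝓝 ((1 - a * 0) / (1 - 0) * y)) :=
      (((h2.const_mul a).const_sub 1).div (h3.const_sub 1) (by simp)).mul_const y
    simpa using h4.norm
  filter_upwards [h1.eventually_lt_const hyr] with n hn
  rw [qCoeff_succ, pow_succ y, norm_norm, norm_norm,
    show qCoeff q a n * ((1 - a * q ^ n) / (1 - q ^ (n + 1))) * (y ^ n * y) =
      ((1 - a * q ^ n) / (1 - q ^ (n + 1)) * y) * (qCoeff q a n * y ^ n) by ring, norm_mul]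
  gcongr

/-- The ratio `(a y; q)_∞ / (y; q)_∞`. -/
def qRatio (q a y : ℂ) : ℂ := qPoch (a * y) q / qPoch y q

theorem qRatio_eq_mul {q : ℂ} (hq : ‖q‖ < 1) (a y : ℂ) :
    qRatio q a y = (1 - a * y) / (1 - y) * qRatio q a (y * q) := by
  rw [qRatio, qRatio, qPoch_eq_one_sub_mul hq (a * y), qPoch_eq_one_sub_mul hq y, mul_assoc a,
    mul_div_mul_comm]

theorem continuousAt_tsum_qCoeff {q : ℂ} (hq : ‖q‖ < 1) (a : ℂ) {x : ℂ} (hx : ‖x‖ < 1) :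
    ContinuousAt (fun y : ℂ => ∑' n, qCoeff q a n * y ^ n) x := by
  obtain ⟨ρ, hxρ, hρ⟩ := exists_between hx
  have hρ0 : ‖(ρ : ℂ)‖ = ρ := by simp [abs_of_nonneg ((norm_nonneg x).trans hxρ.le)]
  have h : ContinuousOn (fun y : ℂ => ∑' n, qCoeff q a n * y ^ n) (Metric.closedBall 0 ρ) := by
    refine continuousOn_tsum (u := fun n => ‖qCoeff q a n * (ρ : ℂ) ^ n‖)
      (fun n => by fun_prop) (summable_norm_qCoeff_mul_pow hq a (by rwa [hρ0])) fun n y hy => ?_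
    rw [norm_mul, norm_mul, norm_pow, norm_pow, hρ0]
    have : ‖y‖ ≤ ρ := by simpa using hy
    gcongr
  exact h.continuousAt (Metric.closedBall_mem_nhds_of_mem (by simpa using hxρ))

/-- The `q`-binomial theorem. -/
theorem tsum_qCoeff_mul_pow {q : ℂ} (hq : ‖q‖ < 1) (a : ℂ) {y : ℂ} (hy : ‖y‖ < 1) :
    ∑' n, qCoeff q a n * y ^ n = qRatio q a y := by
  set F : ℂ → ℂ := fun y => ∑' n, qCoeff q a n * y ^ n with hF
  have hs : ∀ {y : ℂ}, ‖y‖ < 1 → Summable fun n => qCoeff q a n * y ^ n := fun hy =>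
    (summable_norm_qCoeff_mul_pow hq a hy).of_norm
  -- The coefficient recursion becomes a `q`-difference equation. Iterating it moves the argument to
  -- `0`, where `F` is continuous with value `1`.
  have hstep : ∀ {y : ℂ}, ‖y‖ < 1 → (1 - y) * F y = (1 - a * y) * F (y * q) := by
    intro y hy
    have hyq : ‖y * q‖ < 1 := by simpa using norm_mul_pow_lt_one hq hy 1
    have h1 : F y - F (y * q) = y * (F y - a * F (y * q)) := by
      simp only [hF]
      rw [← (hs hy).tsum_sub (hs hyq), ← tsum_mul_left (a := a),
        ← (hs hy).tsum_sub ((hs hyq).mul_left a), ← tsum_mul_left,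
        ((hs hy).sub (hs hyq)).tsum_eq_zero_add]
      simp only [pow_zero, sub_self, zero_add]
      refine tsum_congr fun n => ?_
      rw [mul_pow, mul_pow]
      linear_combination y ^ (n + 1) * qCoeff_succ_mul hq a n
    linear_combination h1
  have hiter : ∀ n : ℕ, F y * ∏ i ∈ Finset.range n, (1 - y * q ^ i)
      = (∏ i ∈ Finset.range n, (1 - a * y * q ^ i)) * F (y * q ^ n) := by
    intro n
    induction n with
    | zero => simp
    | succ n ih =>
      have h1 := hstep (norm_mul_pow_lt_one hq hy n)
      rw [Finset.prod_range_succ, Finset.prod_range_succ, pow_succ q n, ← mul_assoc y]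
      linear_combination (1 - y * q ^ n) * ih +
        (∏ i ∈ Finset.range n, (1 - a * y * q ^ i)) * h1
  have h1 := ((qPoch_multipliable y hq).tendsto_prod_tprod_nat).const_mul (F y)
  have h2 : Tendsto (fun n : ℕ => F (y * q ^ n)) atTop (𝓝 (F 0)) :=
    (continuousAt_tsum_qCoeff hq a (by simp)).tendsto.comp
      (by simpa using (tendsto_pow_zero hq).const_mul y)
  have h3 := (qPoch_multipliable (a * y) hq).tendsto_prod_tprod_nat.mul h2
  have h4 : F 0 = 1 := by
    simp only [hF]
    rw [tsum_eq_single 0 (fun n hn => by simp [hn])]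
    simp
  have h5 := tendsto_nhds_unique h1 (by simpa only [hiter] using h3)
  rw [h4, mul_one] at h5
  rw [qRatio, eq_div_iff (qPoch_ne_zero_of_norm_lt_one hq hy)]
  exact h5

/-- Since `b * (a q^n) = q^(n+1)`, the `q`-binomial sum is a quotient of tails of infinite products.
Read backwards, this makes `qCoeff q a n` a superposition of the geometric sequences `(q^j)^n`. -/
theorem tsum_qCoeff_mul_pow_eq {q a b : ℂ} (hq : ‖q‖ < 1) (ha : ‖a‖ < 1) (hab : a * b = q)
    (n : ℕ) :
    ∑' j, qCoeff q b j * (a * q ^ n) ^ j = qPoch q q / qPoch a q * qCoeff q a n := by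
  have h1 := qPoch_ne_zero_of_norm_lt_one hq ha
  have h2 := qPoch_ne_zero_of_norm_lt_one hq hq
  rw [tsum_qCoeff_mul_pow hq b (norm_mul_pow_lt_one hq ha n), qCoeff_eq hq ha n, qRatio,
    show b * (a * q ^ n) = q ^ (n + 1) by rw [pow_succ, ← hab]; ring]
  field_simp

theorem qRatio_mul_pow {q a b : ℂ} (hq : ‖q‖ < 1) (hb : ‖b‖ < 1) (hab : a * b = q) (n : ℕ) :
    qRatio q a (b * q ^ n) = qPoch q q / qPoch b q * qCoeff q b n := by
  rw [← tsum_qCoeff_mul_pow_eq hq hb (by rw [mul_comm, hab]) n,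
    tsum_qCoeff_mul_pow hq a (norm_mul_pow_lt_one hq hb n)]

/-! ### Partial fractions and quasi-periodicity of `qRatio`. -/

/-- A uniform bound for the inverses of a sequence of the form `1 - q ^ j * y`. -/
theorem exists_norm_inv_one_sub_le {q : ℂ} (hq : ‖q‖ < 1) (y : ℂ) :
    ∃ K, ∀ j : ℕ, ‖(1 - q ^ j * y)⁻¹‖ ≤ K := by
  have h : Tendsto (fun j : ℕ => ‖(1 - q ^ j * y)⁻¹‖) atTop (𝓝 ‖(1 - 0 * y)⁻¹‖) :=
    (((((tendsto_pow_zero hq).mul_const y).const_sub 1)).inv₀ (by simp)).norm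
  obtain ⟨K, hK⟩ := h.bddAbove_range
  exact ⟨K, fun j => hK ⟨j, rfl⟩⟩

theorem Summable.norm_mul_of_bounded {ι : Type*} {f g : ι → ℂ} {K : ℝ}
    (hf : Summable fun i => ‖f i‖) (hg : ∀ i, ‖g i‖ ≤ K) :
    Summable fun i => ‖f i * g i‖ := by
  refine (hf.mul_right K).of_nonneg_of_le (fun _ => norm_nonneg _) fun i => ?_
  rw [norm_mul]
  exact mul_le_mul_of_nonneg_left (hg i) (norm_nonneg _)

theorem summable_norm_qCoeff_div {q a b : ℂ} (hq : ‖q‖ < 1) (ha : ‖a‖ < 1) (y : ℂ) :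
    Summable fun j => ‖qCoeff q b j * a ^ j * (1 - q ^ j * y)⁻¹‖ := by
  obtain ⟨K, hK⟩ := exists_norm_inv_one_sub_le hq y
  exact (summable_norm_qCoeff_mul_pow hq b ha).norm_mul_of_bounded hK

/-- The partial fraction expansion of `qRatio q a`, inside the unit disc. -/
theorem tsum_qCoeff_div_of_norm_lt_one {q a b : ℂ} (hq : ‖q‖ < 1) (ha : ‖a‖ < 1)
    (hab : a * b = q) {y : ℂ} (hy : ‖y‖ < 1) :
    ∑' j, qCoeff q b j * a ^ j * (1 - q ^ j * y)⁻¹ =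
      qPoch q q / qPoch a q * qRatio q a y := by
  have hsum : Summable fun p : ℕ × ℕ => qCoeff q b p.1 * a ^ p.1 * (q ^ p.1 * y) ^ p.2 := by
    refine Summable.of_norm ?_
    have h0 : Summable fun i : ℕ => ‖y ^ i‖ := by
      simpa only [norm_pow] using summable_geometric_of_lt_one (norm_nonneg y) hy
    have h1 : Summable fun p : ℕ × ℕ => ‖qCoeff q b p.1 * a ^ p.1 * y ^ p.2‖ :=
      Summable.mul_norm (f := fun j => qCoeff q b j * a ^ j)
        (summable_norm_qCoeff_mul_pow hq b ha) h0
    refine h1.of_nonneg_of_le (fun _ => norm_nonneg _) fun p => ?_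
    rw [norm_mul, norm_mul _ (y ^ p.2), mul_pow, norm_mul (_ ^ p.2)]
    refine mul_le_mul_of_nonneg_left (mul_le_of_le_one_left (norm_nonneg _) ?_) (norm_nonneg _)
    rw [norm_pow, norm_pow]
    exact pow_le_one₀ (by positivity) (pow_le_one₀ (by positivity) hq.le)
  have hqy : ∀ j : ℕ, ‖q ^ j * y‖ < 1 := fun j => by
    rw [mul_comm]; exact norm_mul_pow_lt_one hq hy j
  -- Expand each fraction geometrically and exchange the sums; the coefficient of `y^i` is then a
  -- `q`-binomial sum.
  calc ∑' j, qCoeff q b j * a ^ j * (1 - q ^ j * y)⁻¹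
      = ∑' j, ∑' i, qCoeff q b j * a ^ j * (q ^ j * y) ^ i := by
        refine tsum_congr fun j => ?_
        rw [tsum_mul_left, tsum_geometric_of_norm_lt_one (hqy j)]
    _ = ∑' i, ∑' j, qCoeff q b j * a ^ j * (q ^ j * y) ^ i := 
        (hsum.tsum_comm (f := fun j i => qCoeff q b j * a ^ j * (q ^ j * y) ^ i)).symm
    _ = ∑' i, qPoch q q / qPoch a q * (qCoeff q a i * y ^ i) := by
        refine tsum_congr fun i => ?_
        rw [← mul_assoc, ← tsum_qCoeff_mul_pow_eq hq ha hab i, ← tsum_mul_right]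
        refine tsum_congr fun j => ?_
        rw [mul_pow, mul_pow, ← pow_mul, ← pow_mul, mul_comm i j]
        ring
    _ = _ := by rw [tsum_mul_left, tsum_qCoeff_mul_pow hq a hy]

/-- The `q`-difference equation of `qRatio q a`, here for the partial fraction series; it carries
the expansion from the unit disc to all `y` off the poles. -/
theorem one_sub_mul_tsum_qCoeff_div {q a b : ℂ} (hq : ‖q‖ < 1) (ha : ‖a‖ < 1)
    (hab : a * b = q) {y : ℂ} (hy : ∀ j : ℕ, 1 - q ^ j * y ≠ 0) :
    (1 - y) * ∑' j, qCoeff q b j * a ^ j * (1 - q ^ j * y)⁻¹ =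
      (1 - a * y) * ∑' j, qCoeff q b j * a ^ j * (1 - q ^ j * (y * q))⁻¹ := by
  have hs : ∀ y, Summable fun j => qCoeff q b j * a ^ j * (1 - q ^ j * y)⁻¹ := fun y =>
    (summable_norm_qCoeff_div hq ha y).of_norm
  have ha1 := one_sub_ne_zero_of_norm_lt_one ha
  -- The disc case at `y = q` gives the sum `1 / (1 - a)`; the resulting `-1` cancels the `j = 0`
  -- term of the left side.
  have hTq : (a - 1) * ∑' j, qCoeff q b j * a ^ j * (1 - q ^ j * q)⁻¹ = -1 := by
    have h1 := qPoch_ne_zero_of_norm_lt_one hq ha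
    have h2 := qPoch_ne_zero_of_norm_lt_one hq hq
    have h3 : ‖a * q‖ < 1 := by simpa using norm_mul_pow_lt_one hq ha 1
    have h4 := qPoch_ne_zero_of_norm_lt_one hq h3
    rw [tsum_qCoeff_div_of_norm_lt_one hq ha hab hq, qRatio, qPoch_eq_one_sub_mul hq a]
    field_simp
    ring
  have hy0 : 1 - y ≠ 0 := by simpa using hy 0
  rw [(hs y).tsum_eq_zero_add, mul_add, ← tsum_mul_left, ← tsum_mul_left]
  have key : ∀ j : ℕ, (1 - y) * (qCoeff q b (j + 1) * a ^ (j + 1) * (1 - q ^ (j + 1) * y)⁻¹) =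
      (1 - a * y) * (qCoeff q b j * a ^ j * (1 - q ^ j * (y * q))⁻¹) +
        (a - 1) * (qCoeff q b j * a ^ j * (1 - q ^ j * q)⁻¹) := by
    intro j
    have h1 := hy (j + 1)
    have h2 := one_sub_pow_succ_ne_zero hq j
    rw [qCoeff_succ, show q ^ j * (y * q) = q ^ (j + 1) * y by ring, ← pow_succ q]
    have h3 : a * (b * q ^ j) = q ^ (j + 1) := by rw [pow_succ, ← hab]; ring
    have h4 : a ^ (j + 1) * (1 - b * q ^ j) = a ^ j * (a - q ^ (j + 1)) := by
      rw [pow_succ, ← h3]; ring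
    generalize q ^ (j + 1) = Q at *
    rw [mul_comm Q y] at h1 ⊢
    clear h3
    field_simp
    linear_combination (qCoeff q b j * (1 - y)) * h4
  simp only [key]
  rw [((hs (y * q)).mul_left _).tsum_add ((hs q).mul_left _), tsum_mul_left, tsum_mul_left, hTq]
  simp [hy0]

/-- The partial fraction expansion of `qRatio q a`. -/
theorem tsum_qCoeff_div {q a b : ℂ} (hq : ‖q‖ < 1) (ha : ‖a‖ < 1)
    (hab : a * b = q) {y : ℂ} (hy : ∀ j : ℕ, 1 - q ^ j * y ≠ 0) :
    ∑' j, qCoeff q b j * a ^ j * (1 - q ^ j * y)⁻¹ =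
      qPoch q q / qPoch a q * qRatio q a y := by
  -- Induction on the number of multiplications by `q` that bring `y` into the disc.
  have hex : ∃ n : ℕ, ‖y * q ^ n‖ < 1 := by
    have h : Tendsto (fun n : ℕ => ‖y * q ^ n‖) atTop (𝓝 0) := by
      simpa using ((tendsto_pow_zero hq).const_mul y).norm
    exact (h.eventually_lt_const one_pos).exists
  obtain ⟨n, hn⟩ := hex
  induction n generalizing y with
  | zero => exact tsum_qCoeff_div_of_norm_lt_one hq ha hab (by simpa using hn)
  | succ n ih =>
    have h1 : 1 - y ≠ 0 := by simpa using hy 0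
    have h2 : ∀ j : ℕ, 1 - q ^ j * (y * q) ≠ 0 := fun j => by
      convert! hy (j + 1) using 2; ring
    have h3 := one_sub_mul_tsum_qCoeff_div hq ha hab hy
    rw [ih h2 (by convert! hn using 2; ring)] at h3
    rw [qRatio_eq_mul hq a y]
    generalize ∑' j, qCoeff q b j * a ^ j * (1 - q ^ j * y)⁻¹ = T at h3 ⊢
    rw [← mul_right_inj' h1, h3]
    field_simp

/-- The quasi-periodicity of `qRatio` under negative powers of `q`. -/
theorem qRatio_div_pow {q a b : ℂ} (hq0 : q ≠ 0) (hq : ‖q‖ < 1) (hab : a * b = q) {y : ℂ}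
    (hy0 : y ≠ 0) (hby : ‖b / y‖ < 1) (hqy : ‖q / y‖ < 1) (j : ℕ) :
    qRatio q a ((q ^ j)⁻¹ * y) = qRatio q a y * a ^ j * (qPoch (b / y) q / qPoch (q / y) q) *
      qRatio q a (b / y * q ^ j) := by
  have ha0 : a ≠ 0 := by rintro rfl; simp at hab; exact hq0 hab.symm
  induction j with
  | zero =>
    have h1 := qPoch_ne_zero_of_norm_lt_one hq hby
    have h2 := qPoch_ne_zero_of_norm_lt_one hq hqy
    simp only [pow_zero, inv_one, one_mul, mul_one]
    rw [qRatio, qRatio, ← mul_div_assoc a, hab]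
    field_simp
  | succ j ih =>
    have h1 := one_sub_ne_zero_of_norm_lt_one (norm_mul_pow_lt_one hq hqy j)
    have h2 := one_sub_ne_zero_of_norm_lt_one (norm_mul_pow_lt_one hq hby j)
    have h3 : (q ^ (j + 1))⁻¹ * y * q = (q ^ j)⁻¹ * y := by
      rw [pow_succ]; field_simp
    rw [qRatio_eq_mul hq a ((q ^ (j + 1))⁻¹ * y), h3, ih,
      qRatio_eq_mul hq a (b / y * q ^ j), mul_assoc (b / y) (q ^ j) q, ← pow_succ q j]
    have hQ : q / y * q ^ j = q ^ (j + 1) / y := by rw [pow_succ']; ring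
    have hA : a * (b / y * q ^ j) = q ^ (j + 1) / y := by rw [← hQ, ← hab]; ring
    rw [hA]
    rw [hQ] at h1
    have h4 : y - q ^ (j + 1) ≠ 0 := by
      intro h; apply h1; rw [← sub_eq_zero.mp h]; simp [hy0]
    have h5 : q ^ (j + 1) - y ≠ 0 := by rw [← neg_sub]; exact neg_ne_zero.mpr h4
    have h6 : q ^ (j + 1) ≠ 0 := pow_ne_zero _ hq0
    have h7 : 1 - (q ^ (j + 1))⁻¹ * y ≠ 0 := by
      intro h; apply h5; field_simp at h; simpa using h
    have h8 : (1 - a * ((q ^ (j + 1))⁻¹ * y)) / (1 - (q ^ (j + 1))⁻¹ * y) =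
        a * (1 - b / y * q ^ j) / (1 - q ^ (j + 1) / y) := by
      rw [div_eq_div_iff h7 h1, mul_sub a, hA]
      field_simp
      ring
    rw [h8]
    generalize 1 - b / y * q ^ j = A at *
    generalize 1 - q ^ (j + 1) / y = B at *
    rw [pow_succ a]
    field_simp

/-! ### Rogers polynomials and their expansion in powers of `q ^ N`. -/

/-- The Rogers (continuous `q`-ultraspherical) polynomial `C_N(x; a | q)`, `2 x = v + v⁻¹`. -/
def rogers (q a v : ℂ) (N : ℕ) : ℂ :=
  ∑ p ∈ Finset.HasAntidiagonal.antidiagonal N,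
    qCoeff q a p.1 * qCoeff q a p.2 * (v⁻¹ ^ p.1 * v ^ p.2)

theorem rogers_mul_pow (q a v y : ℂ) (N : ℕ) :
    rogers q a v N * y ^ N = ∑ p ∈ Finset.HasAntidiagonal.antidiagonal N,
      (qCoeff q a p.1 * (v⁻¹ * y) ^ p.1) * (qCoeff q a p.2 * (v * y) ^ p.2) := by
  rw [rogers, Finset.sum_mul]
  refine Finset.sum_congr rfl fun p hp => ?_
  rw [← Finset.HasAntidiagonal.mem_antidiagonal.mp hp, pow_add, mul_pow, mul_pow]
  ring

theorem summable_norm_rogers {q a v y : ℂ} (hq : ‖q‖ < 1) (h1 : ‖v * y‖ < 1)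
    (h2 : ‖v⁻¹ * y‖ < 1) : Summable fun N => ‖rogers q a v N * y ^ N‖ := by
  simp only [rogers_mul_pow]
  exact summable_norm_sum_mul_antidiagonal_of_summable_norm
    (f := fun i => qCoeff q a i * (v⁻¹ * y) ^ i) (g := fun i => qCoeff q a i * (v * y) ^ i)
    (summable_norm_qCoeff_mul_pow hq a h2) (summable_norm_qCoeff_mul_pow hq a h1)

/-- The generating function of the Rogers polynomials. -/
theorem tsum_rogers {q a v y : ℂ} (hq : ‖q‖ < 1) (h1 : ‖v * y‖ < 1) (h2 : ‖v⁻¹ * y‖ < 1) :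
    ∑' N, rogers q a v N * y ^ N = qRatio q a (v * y) * qRatio q a (v⁻¹ * y) := by
  simp only [rogers_mul_pow]
  rw [← tsum_mul_tsum_eq_tsum_sum_antidiagonal_of_summable_norm
    (f := fun i => qCoeff q a i * (v⁻¹ * y) ^ i) (g := fun i => qCoeff q a i * (v * y) ^ i)
    (summable_norm_qCoeff_mul_pow hq a h2) (summable_norm_qCoeff_mul_pow hq a h1),
    tsum_qCoeff_mul_pow hq a h1, tsum_qCoeff_mul_pow hq a h2, mul_comm]

theorem sum_antidiagonal_pow_mul_pow {X Y : ℂ} (hX : X ≠ 0) (hY : Y ≠ 0) (hXY : X ≠ Y) (N : ℕ) :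
    ∑ p ∈ Finset.HasAntidiagonal.antidiagonal N, Y ^ p.1 * X ^ p.2 =
      X ^ N * (1 - Y / X)⁻¹ + Y ^ N * (1 - X / Y)⁻¹ := by
  have h1 : X - Y ≠ 0 := sub_ne_zero.mpr hXY
  have h2 : Y - X ≠ 0 := sub_ne_zero.mpr hXY.symm
  rw [Finset.Nat.sum_antidiagonal_eq_sum_range_succ (fun i j => Y ^ i * X ^ j),
    show ∑ k ∈ Finset.range N.succ, Y ^ k * X ^ (N - k) =
      ∑ k ∈ Finset.range (N + 1), Y ^ k * X ^ (N + 1 - 1 - k) from rfl,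
    (Commute.all Y X).geom_sum₂ hXY.symm, one_sub_div hX, one_sub_div hY, ← neg_sub Y X]
  field_simp
  ring

/-- The points are `q^(j-l) w` with `j - l ∈ ℤ`. They stay away from `1`: for `j > l` their norm is
at most `‖q w‖ < 1`, for `j < l` at least `‖q w⁻¹‖⁻¹ > 1`, and for `j = l` the point is `w ≠ 1`. -/
theorem exists_norm_inv_one_sub_mul_inv_le {q w : ℂ} (hq0 : q ≠ 0) (hq : ‖q‖ < 1) (hw0 : w ≠ 0)
    (hw1 : w ≠ 1) (hqw : ‖q * w‖ < 1) (hqw' : ‖q * w⁻¹‖ < 1) :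
    ∃ K, ∀ l j : ℕ, 1 - q ^ j * ((q ^ l)⁻¹ * w) ≠ 0 ∧
      ‖(1 - q ^ j * ((q ^ l)⁻¹ * w))⁻¹‖ ≤ K := by
  have hsmall : ∀ {u : ℂ}, ‖q * u‖ < 1 → ∀ m : ℕ, ‖q ^ (m + 1) * u‖ ≤ ‖q * u‖ := by
    intro u hu m
    rw [pow_succ, mul_assoc, norm_mul, norm_pow]
    exact mul_le_of_le_one_left (norm_nonneg _) (pow_le_one₀ (norm_nonneg _) hq.le)
  have hw1' : 1 - w ≠ 0 := sub_ne_zero.mpr hw1.symm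
  refine ⟨max ‖(1 - w)⁻¹‖ (max (1 - ‖q * w‖)⁻¹ (‖q * w⁻¹‖⁻¹ - 1)⁻¹), fun l j => ?_⟩
  rcases lt_trichotomy l j with h | h | h
  · obtain ⟨m, rfl⟩ := Nat.exists_eq_add_of_lt h
    have e : q ^ (l + m + 1) * ((q ^ l)⁻¹ * w) = q ^ (m + 1) * w := by
      rw [add_assoc, pow_add]; field_simp
    rw [e]
    have h1 : 1 - ‖q * w‖ ≤ ‖1 - q ^ (m + 1) * w‖ := by
      have := norm_sub_norm_le (1 : ℂ) (q ^ (m + 1) * w)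
      rw [norm_one] at this
      linarith [hsmall hqw m]
    have h2 : 0 < 1 - ‖q * w‖ := by linarith
    refine ⟨norm_pos_iff.mp (h2.trans_le h1), ?_⟩
    rw [norm_inv]
    exact (inv_anti₀ h2 h1).trans ((le_max_left _ _).trans (le_max_right _ _))
  · subst h
    have e : q ^ l * ((q ^ l)⁻¹ * w) = w := by field_simp
    rw [e]
    exact ⟨hw1', le_max_left _ _⟩
  · obtain ⟨m, rfl⟩ := Nat.exists_eq_add_of_lt h
    have e : q ^ j * ((q ^ (j + m + 1))⁻¹ * w) = (q ^ (m + 1) * w⁻¹)⁻¹ := by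
      rw [add_assoc, pow_add]; field_simp
    rw [e]
    have h0 : 0 < ‖q * w⁻¹‖ := norm_pos_iff.mpr (mul_ne_zero hq0 (inv_ne_zero hw0))
    have h00 : 0 < ‖q ^ (m + 1) * w⁻¹‖ :=
      norm_pos_iff.mpr (mul_ne_zero (pow_ne_zero _ hq0) (inv_ne_zero hw0))
    have h1 : ‖q * w⁻¹‖⁻¹ - 1 ≤ ‖1 - (q ^ (m + 1) * w⁻¹)⁻¹‖ := by
      have h3 := norm_sub_norm_le (q ^ (m + 1) * w⁻¹)⁻¹ (1 : ℂ)
      rw [norm_one, norm_sub_rev, norm_inv] at h3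
      linarith [inv_anti₀ h00 (hsmall hqw' m)]
    have h2 : 0 < ‖q * w⁻¹‖⁻¹ - 1 := by linarith [(one_lt_inv₀ h0).mpr hqw']
    refine ⟨norm_pos_iff.mp (h2.trans_le h1), ?_⟩
    rw [norm_inv]
    exact (inv_anti₀ h2 h1).trans ((le_max_right _ _).trans (le_max_right _ _))

/-- One of the two halves of the expansion of a Rogers polynomial in powers of `q ^ N`. -/
def rogersHalf (q a b v : ℂ) (N : ℕ) : ℂ :=
  ∑' l, qCoeff q b l * a ^ l * qRatio q a ((q ^ l)⁻¹ * (v ^ 2)⁻¹) * (q ^ l * v) ^ N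

section

variable {q a b v : ℂ}

theorem hasSum_rogersHalf (hq0 : q ≠ 0) (hq : ‖q‖ < 1)
    (ha : ‖a‖ < 1) (hab : a * b = q) (hv0 : v ≠ 0) (hv1 : v ^ 2 ≠ 1) (hqv : ‖q * v ^ 2‖ < 1)
    (hqv' : ‖q * (v ^ 2)⁻¹‖ < 1) (N : ℕ) :
    HasSum (fun p : ℕ × ℕ => (qCoeff q b p.1 * a ^ p.1) * (qCoeff q b p.2 * a ^ p.2) *
      ((q ^ p.1 * v) ^ N * (1 - q ^ p.2 * ((q ^ p.1)⁻¹ * (v ^ 2)⁻¹))⁻¹))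
      (qPoch q q / qPoch a q * rogersHalf q a b v N) := by
  obtain ⟨K, hK⟩ := exists_norm_inv_one_sub_mul_inv_le (w := (v ^ 2)⁻¹) hq0 hq
    (inv_ne_zero (pow_ne_zero 2 hv0)) (inv_ne_one.mpr hv1) hqv' (by rwa [inv_inv])
  have hs0 := summable_norm_qCoeff_mul_pow hq b ha
  have hs : Summable fun p : ℕ × ℕ => (qCoeff q b p.1 * a ^ p.1) * (qCoeff q b p.2 * a ^ p.2) *
      ((q ^ p.1 * v) ^ N * (1 - q ^ p.2 * ((q ^ p.1)⁻¹ * (v ^ 2)⁻¹))⁻¹) := by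
    have hs2 : Summable fun p : ℕ × ℕ =>
        ‖(qCoeff q b p.1 * a ^ p.1) * (qCoeff q b p.2 * a ^ p.2)‖ :=
      Summable.mul_norm (f := fun j => qCoeff q b j * a ^ j)
        (g := fun j => qCoeff q b j * a ^ j) hs0 hs0
    refine Summable.of_norm (Summable.norm_mul_of_bounded (K := ‖v‖ ^ N * K) hs2 fun p => ?_)
    rw [norm_mul, norm_pow, norm_mul, norm_pow]
    refine mul_le_mul (pow_le_pow_left₀ (by positivity) (mul_le_of_le_one_left (norm_nonneg _)
      (pow_le_one₀ (norm_nonneg _) hq.le)) _) (hK p.1 p.2).2 (norm_nonneg _) (by positivity)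
  convert! hs.hasSum using 1
  rw [hs.tsum_prod, rogersHalf, ← tsum_mul_left]
  refine tsum_congr fun l => ?_
  rw [show ∀ T : ℂ, qPoch q q / qPoch a q * (qCoeff q b l * a ^ l * T * (q ^ l * v) ^ N) =
      qCoeff q b l * a ^ l * (q ^ l * v) ^ N * (qPoch q q / qPoch a q * T) from fun T => by ring,
    ← tsum_qCoeff_div hq ha hab (fun j => (hK l j).1), ← tsum_mul_left]
  refine tsum_congr fun j => ?_
  ring

/-- Writing both coefficients of `rogers` as superpositions of geometric sequences leaves finite
geometric sums in `X = q^l v` and `Y = q^j v⁻¹`. Each splits into an `X^N` part and a `Y^N` part;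
summing out the other index by partial fractions gives the two halves. -/
theorem rogers_eq_half_add_half (hq0 : q ≠ 0) (hq : ‖q‖ < 1)
    (ha : ‖a‖ < 1) (hab : a * b = q) (hv0 : v ≠ 0) (hv1 : v ^ 2 ≠ 1) (hqv : ‖q * v ^ 2‖ < 1)
    (hqv' : ‖q * (v ^ 2)⁻¹‖ < 1) (N : ℕ) :
    rogers q a v N =
      qPoch a q / qPoch q q * (rogersHalf q a b v N + rogersHalf q a b v⁻¹ N) := by
  have hPa := qPoch_ne_zero_of_norm_lt_one hq ha
  have hPq := qPoch_ne_zero_of_norm_lt_one hq hq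
  have hs0 := summable_norm_qCoeff_mul_pow hq b ha
  have hbd : ∀ i : ℕ, Summable fun j => ‖qCoeff q b j * a ^ j * (q ^ j) ^ i‖ := fun i =>
    hs0.norm_mul_of_bounded (K := 1) fun j => by
      rw [norm_pow, norm_pow]
      exact pow_le_one₀ (by positivity) (pow_le_one₀ (by positivity) hq.le)
  have hc : ∀ i : ℕ, ∑' j, qCoeff q b j * a ^ j * (q ^ j) ^ i =
      qPoch q q / qPoch a q * qCoeff q a i := fun i => by
    rw [← tsum_qCoeff_mul_pow_eq hq ha hab i]
    refine tsum_congr fun j => ?_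
    rw [mul_pow, ← pow_mul, ← pow_mul, mul_comm i j, mul_assoc]
  obtain ⟨K, hK⟩ := exists_norm_inv_one_sub_mul_inv_le (w := (v ^ 2)⁻¹) hq0 hq
    (inv_ne_zero (pow_ne_zero 2 hv0)) (inv_ne_one.mpr hv1) hqv' (by rwa [inv_inv])
  have H1 := hasSum_rogersHalf hq0 hq ha hab hv0 hv1 hqv hqv' N
  have H2 := hasSum_rogersHalf (v := v⁻¹) hq0 hq ha hab (inv_ne_zero hv0)
    (by rw [inv_pow]; exact inv_ne_one.mpr hv1) (by rwa [inv_pow]) (by rwa [inv_pow, inv_inv]) N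
  have H3 := H1.add ((Equiv.prodComm ℕ ℕ).hasSum_iff.mpr H2)
  have H4 : HasSum (fun p : ℕ × ℕ => ∑ r ∈ Finset.HasAntidiagonal.antidiagonal N,
      (qCoeff q b p.1 * a ^ p.1 * (q ^ p.1) ^ r.2) * (qCoeff q b p.2 * a ^ p.2 * (q ^ p.2) ^ r.1) *
        (v⁻¹ ^ r.1 * v ^ r.2))
      (∑ r ∈ Finset.HasAntidiagonal.antidiagonal N, (qPoch q q / qPoch a q * qCoeff q a r.2) *
        (qPoch q q / qPoch a q * qCoeff q a r.1) * (v⁻¹ ^ r.1 * v ^ r.2)) := by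
    refine hasSum_sum fun r _ => HasSum.mul_right _ ?_
    rw [← hc, ← hc, tsum_mul_tsum_of_summable_norm (hbd _) (hbd _)]
    exact (summable_mul_of_summable_norm (hbd r.2) (hbd r.1)).hasSum
  have H5 := H4.unique (by
    convert! H3 using 2 with p
    have hX : q ^ p.1 * v ≠ 0 := mul_ne_zero (pow_ne_zero _ hq0) hv0
    have hY : q ^ p.2 * v⁻¹ ≠ 0 := mul_ne_zero (pow_ne_zero _ hq0) (inv_ne_zero hv0)
    have hYX : q ^ p.2 * v⁻¹ / (q ^ p.1 * v) = q ^ p.2 * ((q ^ p.1)⁻¹ * (v ^ 2)⁻¹) := by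
      field_simp
    have hXY : q ^ p.1 * v / (q ^ p.2 * v⁻¹) = q ^ p.1 * ((q ^ p.2)⁻¹ * (v⁻¹ ^ 2)⁻¹) := by
      field_simp
    have hne : q ^ p.1 * v ≠ q ^ p.2 * v⁻¹ := fun h => by
      have := (hK p.1 p.2).1
      rw [← hYX, ← h, div_self hX, sub_self] at this
      exact this rfl
    have h6 := sum_antidiagonal_pow_mul_pow hX hY hne N
    rw [hYX, hXY] at h6
    simp only [Function.comp, Equiv.prodComm_apply, Prod.fst_swap, Prod.snd_swap]
    rw [show ∀ A B C D E F : ℂ, A * B * C + B * A * D = A * B * (C + D) from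
      fun A B C D E F => by ring]
    · rw [← h6, Finset.mul_sum]
      refine Finset.sum_congr rfl fun r _ => ?_
      rw [mul_pow, mul_pow]
      ring
    -- The variables `E` and `F` do not occur in the auxiliary identity, so any values serve.
    · exact 0
    · exact 0)
  rw [← mul_add] at H5
  have H6 : (qPoch q q / qPoch a q) ^ 2 * rogers q a v N =
      qPoch q q / qPoch a q * (rogersHalf q a b v N + rogersHalf q a b v⁻¹ N) := by
    rw [← H5, rogers, Finset.mul_sum]
    refine Finset.sum_congr rfl fun r _ => ?_
    ring
  field_simp at H6 ⊢
  linear_combination H6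

end

/-! ### The block series and its symmetry in `a ↔ b`. -/

theorem exists_norm_qRatio_mul_pow_le {q : ℂ} (hq : ‖q‖ < 1) (a : ℂ) {y : ℂ} (hy : ‖y‖ < 1) :
    ∃ K, ∀ j : ℕ, ‖qRatio q a (y * q ^ j)‖ ≤ K := by
  have hs := summable_norm_qCoeff_mul_pow hq a hy
  refine ⟨∑' n, ‖qCoeff q a n * y ^ n‖, fun j => ?_⟩
  rw [← tsum_qCoeff_mul_pow hq a (norm_mul_pow_lt_one hq hy j)]
  refine tsum_of_norm_bounded hs.hasSum fun n => ?_
  rw [norm_mul, norm_mul, norm_pow, norm_pow]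
  gcongr
  rw [norm_mul, norm_pow]
  exact mul_le_of_le_one_right (norm_nonneg _) (pow_le_one₀ (norm_nonneg _) hq.le)

/-- The terms of the basic hypergeometric series to which the sum over residues factorizes. -/
def blockTerm (q a b x : ℂ) (j : ℕ) : ℂ := qCoeff q b j * a ^ j * qRatio q a (b * x * q ^ j)

theorem summable_norm_blockTerm {q a b x : ℂ} (hq : ‖q‖ < 1) (ha : ‖a‖ < 1)
    (hbx : ‖b * x‖ < 1) : Summable fun j => ‖blockTerm q a b x j‖ := by
  obtain ⟨K, hK⟩ := exists_norm_qRatio_mul_pow_le hq a hbx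
  exact (summable_norm_qCoeff_mul_pow hq b ha).norm_mul_of_bounded hK

/-- In each term the factors `(b q^j; q)_∞` and `(b x q^j; q)_∞` can be regrouped into `qRatio q (a
* x) (b * q ^ j)`, which the `q`-binomial theorem expands. The double series is invariant under
exchanging `a` with `b` together with the two indices. -/
theorem tsum_blockTerm_mul {q a b x : ℂ} (hq : ‖q‖ < 1) (ha : ‖a‖ < 1) (hb : ‖b‖ < 1)
    (hab : a * b = q) (hbx : ‖b * x‖ < 1) :
    qPoch (b * x) q * ∑' j, blockTerm q a b x j =
      qPoch b q * ∑' p : ℕ × ℕ, qCoeff q (b * x) p.1 * a ^ p.1 *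
        (qCoeff q (a * x) p.2 * b ^ p.2) * q ^ (p.1 * p.2) := by
  have hs : Summable fun p : ℕ × ℕ => qCoeff q (b * x) p.1 * a ^ p.1 *
        (qCoeff q (a * x) p.2 * b ^ p.2) * q ^ (p.1 * p.2) := by
    have h2 : Summable fun p : ℕ × ℕ => ‖qCoeff q (b * x) p.1 * a ^ p.1 *
        (qCoeff q (a * x) p.2 * b ^ p.2)‖ :=
      Summable.mul_norm (f := fun j => qCoeff q (b * x) j * a ^ j)
        (g := fun j => qCoeff q (a * x) j * b ^ j) (summable_norm_qCoeff_mul_pow hq _ ha)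
        (summable_norm_qCoeff_mul_pow hq _ hb)
    refine (h2.norm_mul_of_bounded (K := 1) fun p => ?_).of_norm
    rw [norm_pow]
    exact pow_le_one₀ (norm_nonneg _) hq.le
  rw [hs.tsum_prod, ← tsum_mul_left, ← tsum_mul_left]
  refine tsum_congr fun j => ?_
  have hbj := norm_mul_pow_lt_one hq hb j
  have h1 : ∑' n, qCoeff q (b * x) j * a ^ j * (qCoeff q (a * x) n * b ^ n) * q ^ (j * n) =
      qCoeff q (b * x) j * a ^ j * qRatio q (a * x) (b * q ^ j) := by
    rw [← tsum_qCoeff_mul_pow hq _ hbj, ← tsum_mul_left]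
    refine tsum_congr fun n => ?_
    rw [mul_pow, ← pow_mul]
    ring
  rw [h1, blockTerm, qCoeff_eq hq hb, qCoeff_eq hq hbx, qRatio, qRatio,
    show a * (b * x * q ^ j) = q * x * q ^ j by rw [← hab]; ring,
    show a * x * (b * q ^ j) = q * x * q ^ j by rw [← hab]; ring]
  have h2 := qPoch_ne_zero_of_norm_lt_one hq hbj
  have h3 := qPoch_ne_zero_of_norm_lt_one hq (norm_mul_pow_lt_one hq hbx j)
  have h4 := qPoch_ne_zero_of_norm_lt_one hq hq
  field_simp

/-- The symmetry of the basic hypergeometric series (a case of the Heine--Euler transformation). -/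
theorem tsum_blockTerm_symm {q a b x : ℂ} (hq : ‖q‖ < 1) (ha : ‖a‖ < 1) (hb : ‖b‖ < 1)
    (hab : a * b = q) (hax : ‖a * x‖ < 1) (hbx : ‖b * x‖ < 1) :
    qPoch a q * (qPoch (b * x) q * ∑' j, blockTerm q a b x j) =
      qPoch b q * (qPoch (a * x) q * ∑' j, blockTerm q b a x j) := by
  rw [tsum_blockTerm_mul hq ha hb hab hbx,
    tsum_blockTerm_mul hq hb ha (by rw [mul_comm, hab]) hax, ← (Equiv.prodComm ℕ ℕ).tsum_eq]
  have h : ∀ p : ℕ × ℕ, qCoeff q (b * x) (Equiv.prodComm ℕ ℕ p).1 * a ^ (Equiv.prodComm ℕ ℕ p).1 *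
      (qCoeff q (a * x) (Equiv.prodComm ℕ ℕ p).2 * b ^ (Equiv.prodComm ℕ ℕ p).2) *
      q ^ ((Equiv.prodComm ℕ ℕ p).1 * (Equiv.prodComm ℕ ℕ p).2) =
      qCoeff q (a * x) p.1 * b ^ p.1 * (qCoeff q (b * x) p.2 * a ^ p.2) * q ^ (p.1 * p.2) := by
    intro p
    simp only [Equiv.prodComm_apply, Prod.fst_swap, Prod.snd_swap]
    rw [mul_comm p.2 p.1]
    ring
  simp only [h]
  ring

/-! ### Factorization of the sum over fluxes. -/

section

variable {q a b v : ℂ}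

/-- Insert the series of `rogersHalf` and sum over `N` first: the generating function at `b v
q^(k+l)` supplies the block term of index `l + k`. -/
theorem hasSum_rogers_mul_rogersHalf (hq0 : q ≠ 0) (hq : ‖q‖ < 1) (ha : ‖a‖ < 1) (hb : ‖b‖ < 1)
    (hab : a * b = q) (hv0 : v ≠ 0) (hbv : ‖b * v ^ 2‖ < 1) (hqv : ‖q * v ^ 2‖ < 1) (k : ℕ) :
    HasSum (fun N => a ^ k * (rogers q a v N * (b * q ^ k) ^ N * rogersHalf q a b v N))
      (qPoch q q / qPoch b q * (qRatio q a (v ^ 2)⁻¹ *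
        (qPoch (b * v ^ 2) q / qPoch (q * v ^ 2) q)) *
        ∑' l, blockTerm q a b (v ^ 2) l * blockTerm q a b (v ^ 2) (l + k)) := by
  set c : ℂ := qRatio q a (v ^ 2)⁻¹ * (qPoch (b * v ^ 2) q / qPoch (q * v ^ 2) q) with hc
  -- Quasi-periodicity yields a second `a ^ l`, which joins the prefactor `a ^ k` to form the `a ^
  -- (l + k)` of the other block term.
  have hD : ∀ l : ℕ, qCoeff q b l * a ^ l * qRatio q a ((q ^ l)⁻¹ * (v ^ 2)⁻¹) =
      c * (blockTerm q a b (v ^ 2) l * a ^ l) := fun l => by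
    rw [qRatio_div_pow hq0 hq hab (inv_ne_zero (pow_ne_zero 2 hv0)) (by rwa [div_inv_eq_mul])
      (by rwa [div_inv_eq_mul]), div_inv_eq_mul, div_inv_eq_mul, hc, blockTerm]
    ring
  have hbvv : ‖v * (b * v)‖ < 1 := by convert! hbv using 2; ring
  have hbv' : ‖v⁻¹ * (b * v)‖ < 1 := by convert! hb using 2; field_simp
  have hpow : ∀ {u w : ℂ}, ‖u * w‖ < 1 → ∀ m : ℕ, ‖u * (w * q ^ m)‖ < 1 := fun h m => by
    rw [← mul_assoc]; exact norm_mul_pow_lt_one hq h m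
  have hE : Summable fun l => ‖c * (blockTerm q a b (v ^ 2) l * a ^ l)‖ := by
    have h := (summable_norm_blockTerm hq ha hbv).norm_mul_of_bounded (g := fun l => a ^ l) (K := 1)
      fun l => by rw [norm_pow]; exact pow_le_one₀ (norm_nonneg _) ha.le
    refine (h.mul_left ‖c‖).congr fun l => ?_
    rw [norm_mul c]
  have hs : Summable fun p : ℕ × ℕ => a ^ k * (c * (blockTerm q a b (v ^ 2) p.2 * a ^ p.2) *
      (rogers q a v p.1 * (b * v * q ^ (k + p.2)) ^ p.1)) := by
    have h2 : Summable fun p : ℕ × ℕ => ‖(rogers q a v p.1 * (b * v) ^ p.1) *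
        (c * (blockTerm q a b (v ^ 2) p.2 * a ^ p.2))‖ :=
      Summable.mul_norm (f := fun N => rogers q a v N * (b * v) ^ N)
        (g := fun l => c * (blockTerm q a b (v ^ 2) l * a ^ l))
        (summable_norm_rogers hq hbvv hbv') hE
    refine Summable.mul_left _ ((h2.norm_mul_of_bounded
      (g := fun p : ℕ × ℕ => (q ^ (k + p.2)) ^ p.1) (K := 1) fun p => ?_).of_norm.congr fun p => ?_)
    · rw [norm_pow, norm_pow]
      exact pow_le_one₀ (by positivity) (pow_le_one₀ (norm_nonneg _) hq.le)
    · rw [mul_pow _ (q ^ (k + p.2))]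
      ring
  have H := hs.hasSum.prod_fiberwise fun N => (hs.prod_factor N).hasSum
  convert! H using 1
  · funext N
    rw [rogersHalf, ← tsum_mul_left, ← tsum_mul_left]
    refine tsum_congr fun l => ?_
    rw [hD l, pow_add, mul_pow, mul_pow, mul_pow, mul_pow, mul_pow]
    ring
  · rw [← (Equiv.prodComm ℕ ℕ).tsum_eq]
    have hs' := (Equiv.prodComm ℕ ℕ).summable_iff.mpr hs
    refine Eq.trans ?_ (Summable.tsum_prod hs').symm
    rw [← tsum_mul_left]
    refine tsum_congr fun l => ?_
    simp only [Function.comp, Equiv.prodComm_apply, Prod.swap_prod_mk]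
    rw [tsum_mul_left, tsum_mul_left, tsum_rogers hq (hpow hbvv _) (hpow hbv' _),
      show v * (b * v * q ^ (k + l)) = b * v ^ 2 * q ^ (l + k) by rw [add_comm]; ring,
      show v⁻¹ * (b * v * q ^ (k + l)) = b * q ^ (l + k) by rw [add_comm]; field_simp,
      qRatio_mul_pow hq hb hab, blockTerm, blockTerm, pow_add a]
    ring

/-- The contribution of one of the two sequences of poles. -/
def blockFactor (q a b x : ℂ) : ℂ :=
  qPoch a q / qPoch b q * (qRatio q a x⁻¹ * (qPoch (b * x) q / qPoch (q * x) q))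

theorem rogers_inv (q a v : ℂ) (N : ℕ) : rogers q a v⁻¹ N = rogers q a v N := by
  rw [rogers, rogers, ← Finset.sum_equiv (Equiv.prodComm ℕ ℕ)
    (s := Finset.HasAntidiagonal.antidiagonal N)
    (f := fun p => qCoeff q a p.1 * qCoeff q a p.2 * (v⁻¹ ^ p.1 * v ^ p.2))]
  · intro p
    simp [Finset.HasAntidiagonal.mem_antidiagonal, add_comm]
  · intro p _
    simp only [Equiv.prodComm_apply, Prod.fst_swap, Prod.snd_swap, inv_inv]
    ring

theorem hasSum_rogers_sq (hq0 : q ≠ 0) (hq : ‖q‖ < 1) (ha : ‖a‖ < 1) (hb : ‖b‖ < 1)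
    (hab : a * b = q) (hv0 : v ≠ 0) (hv1 : v ^ 2 ≠ 1) (hbv : ‖b * v ^ 2‖ < 1)
    (hbv' : ‖b * (v ^ 2)⁻¹‖ < 1) (hqv : ‖q * v ^ 2‖ < 1) (hqv' : ‖q * (v ^ 2)⁻¹‖ < 1) (k : ℕ) :
    HasSum (fun N => a ^ k * (rogers q a v N ^ 2 * (b * q ^ k) ^ N))
      (blockFactor q a b (v ^ 2) *
          ∑' l, blockTerm q a b (v ^ 2) l * blockTerm q a b (v ^ 2) (l + k) +
        blockFactor q a b (v ^ 2)⁻¹ *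
          ∑' l, blockTerm q a b (v ^ 2)⁻¹ l * blockTerm q a b (v ^ 2)⁻¹ (l + k)) := by
  have hPq := qPoch_ne_zero_of_norm_lt_one hq hq
  have H1 := hasSum_rogers_mul_rogersHalf hq0 hq ha hb hab hv0 hbv hqv k
  have H2 := hasSum_rogers_mul_rogersHalf hq0 hq ha hb hab (inv_ne_zero hv0)
    (by rwa [inv_pow]) (by rwa [inv_pow]) k
  simp only [inv_pow, rogers_inv] at H2
  convert! (H1.add H2).mul_left (qPoch a q / qPoch q q) using 1
  · funext N
    rw [pow_two]
    nth_rw 2 [rogers_eq_half_add_half hq0 hq ha hab hv0 hv1 hqv hqv' N]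
    ring
  · rw [blockFactor, blockFactor]
    field_simp

end

/-- A double sum over integers and naturals as the square of a simple sum. -/
theorem hasSum_int_mul_natAbs {E : ℕ → ℂ} (hE : Summable fun j => ‖E j‖) :
    HasSum (fun k : ℤ => ∑' l, E l * E (l + k.natAbs)) ((∑' j, E j) ^ 2) := by
  have hs : HasSum (fun p : ℕ × ℕ => E p.1 * E p.2) ((∑' j, E j) ^ 2) := by
    rw [pow_two, tsum_mul_tsum_of_summable_norm hE hE]
    exact (summable_mul_of_summable_norm hE hE).hasSum
  -- A pair of naturals is encoded by its difference `k` and its minimum `l`; the larger entry is `l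
  -- + |k|`.
  let e : ℤ × ℕ ≃ ℕ × ℕ :=
    { toFun := fun p => (p.2 + p.1.toNat, p.2 + (-p.1).toNat)
      invFun := fun p => ((p.1 : ℤ) - p.2, min p.1 p.2)
      left_inv := fun p => by
        ext <;> simp
        omega
      right_inv := fun p => by ext <;> simp <;> omega }
  have h := e.hasSum_iff.mpr hs
  have h2 := h.prod_fiberwise fun k => (h.summable.prod_factor k).hasSum
  convert! h2 using 1
  funext k
  refine tsum_congr fun l => ?_
  rcases le_total 0 k with hk | hk
  · have h3 : k.natAbs = k.toNat := by omega
    have h4 : (-k).toNat = 0 := by omega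
    simp [e, h3, h4, mul_comm]
  · have h3 : k.natAbs = (-k).toNat := by omega
    have h4 : k.toNat = 0 := by omega
    simp [e, h3, h4]

/-- Each side is the square of a side of `tsum_blockTerm_symm` times a factor symmetric in `a` and
`b`. -/
theorem qPoch_mul_qPoch_mul_blockFactor_symm {q a b x : ℂ} (hq : ‖q‖ < 1) (ha : ‖a‖ < 1)
    (hb : ‖b‖ < 1) (hab : a * b = q) (hax : ‖a * x‖ < 1) (hbx : ‖b * x‖ < 1) :
    qPoch (b * x) q * qPoch (b * x⁻¹) q *
        (blockFactor q a b x * (∑' j, blockTerm q a b x j) ^ 2) =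
      qPoch (a * x) q * qPoch (a * x⁻¹) q *
        (blockFactor q b a x * (∑' j, blockTerm q b a x j) ^ 2) := by
  have hPa := qPoch_ne_zero_of_norm_lt_one hq ha
  have hPb := qPoch_ne_zero_of_norm_lt_one hq hb
  have h := tsum_blockTerm_symm hq ha hb hab hax hbx
  generalize ∑' j, blockTerm q a b x j = S at h ⊢
  generalize ∑' j, blockTerm q b a x j = T at h ⊢
  rw [blockFactor, blockFactor, qRatio, qRatio]
  calc _ = qPoch (a * x⁻¹) q * qPoch (b * x⁻¹) q * (qPoch x⁻¹ q)⁻¹ * (qPoch (q * x) q)⁻¹ *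
        (qPoch a q)⁻¹ * (qPoch b q)⁻¹ * (qPoch a q * (qPoch (b * x) q * S)) ^ 2 := by
        field_simp
    _ = _ := by
        rw [h]
        field_simp

/-! ### Convergence and continuity of the sector sums; the symmetry for all `v`. -/

/-- The sum over `N` of squares of Rogers polynomials giving the index in the flux sector `k`. -/
def sectorSum (q a b : ℂ) (k : ℤ) (v : ℂ) : ℂ :=
  a ^ k.natAbs * ∑' N, rogers q a v N ^ 2 * (b * q ^ k.natAbs) ^ N

/-- A bound for Rogers polynomials. -/
def rogersBound (q a : ℂ) (t : ℝ) (N : ℕ) : ℝ :=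
  ∑ p ∈ Finset.HasAntidiagonal.antidiagonal N,
    (‖qCoeff q a p.1‖ * t ^ p.1) * (‖qCoeff q a p.2‖ * t ^ p.2)

theorem summable_rogersBound_sq {q : ℂ} (hq : ‖q‖ < 1) (a : ℂ) {t : ℝ} (ht0 : 0 ≤ t)
    (ht : t < 1) : Summable fun N => rogersBound q a t N ^ 2 := by
  have h1 : Summable fun n => ‖‖qCoeff q a n‖ * t ^ n‖ := by
    have h := summable_norm_qCoeff_mul_pow hq a (y := (t : ℂ)) (by simpa [abs_of_nonneg ht0])
    simpa [abs_of_nonneg ht0] using h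
  have h2 : Summable fun N => ‖rogersBound q a t N‖ :=
    summable_norm_sum_mul_antidiagonal_of_summable_norm
      (f := fun n => ‖qCoeff q a n‖ * t ^ n) (g := fun n => ‖qCoeff q a n‖ * t ^ n) h1 h1
  -- The squares are the diagonal of a summable double family.
  have h3 := (summable_mul_of_summable_norm (f := rogersBound q a t) (g := rogersBound q a t)
    h2 h2).comp_injective (i := fun N : ℕ => (N, N)) fun i j h => (Prod.ext_iff.mp h).1
  refine h3.congr fun N => ?_
  simp [pow_two]

/-- With `β = √‖b‖`, the weight `‖b‖^N` is shared equally by the two Rogers factors. The bound is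
uniform in `k` and in `v` on an annulus. -/
theorem norm_rogers_sq_le {q a b v : ℂ} {V β : ℝ} (hq : ‖q‖ < 1) (hβ : β ^ 2 = ‖b‖) (hβ0 : 0 ≤ β)
    (hv : ‖v‖ ≤ V) (hv' : ‖v⁻¹‖ ≤ V) (k N : ℕ) :
    ‖rogers q a v N ^ 2 * (b * q ^ k) ^ N‖ ≤ rogersBound q a (V * β) N ^ 2 := by
  have hVβ : 0 ≤ V * β := mul_nonneg ((norm_nonneg v).trans hv) hβ0
  have h1 : ‖rogers q a v N‖ * β ^ N ≤ rogersBound q a (V * β) N := by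
    have h2 : ‖rogers q a v N‖ * β ^ N = ‖rogers q a v N * (β : ℂ) ^ N‖ := by
      rw [norm_mul, norm_pow, Complex.norm_real, Real.norm_of_nonneg hβ0]
    rw [h2, rogers_mul_pow]
    refine (norm_sum_le _ _).trans (Finset.sum_le_sum fun p _ => ?_)
    simp only [norm_mul, norm_pow, Complex.norm_real, Real.norm_of_nonneg hβ0]
    gcongr
  calc ‖rogers q a v N ^ 2 * (b * q ^ k) ^ N‖
      = (‖rogers q a v N‖ * β ^ N) ^ 2 * (‖q‖ ^ k) ^ N := by
        rw [norm_mul, norm_pow, norm_pow, norm_mul, norm_pow, ← hβ]; ring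
    _ ≤ (‖rogers q a v N‖ * β ^ N) ^ 2 * 1 := by
        gcongr
        exact pow_le_one₀ (by positivity) (pow_le_one₀ (norm_nonneg _) hq.le)
    _ ≤ _ := by
        rw [mul_one]
        gcongr

theorem summable_pow_natAbs {x : ℝ} (h0 : 0 ≤ x) (h1 : x < 1) :
    Summable fun k : ℤ => x ^ k.natAbs := by
  have := summable_geometric_of_lt_one h0 h1
  exact Summable.of_nat_of_neg (by simpa using this) (by simpa using this)

theorem norm_sectorSum_le {q a b v : ℂ} {V β : ℝ} (hq : ‖q‖ < 1)
    (hβ : β ^ 2 = ‖b‖) (hβ0 : 0 ≤ β) (hVβ : V * β < 1) (hv : ‖v‖ ≤ V) (hv' : ‖v⁻¹‖ ≤ V) (k : ℤ) :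
    ‖sectorSum q a b k v‖ ≤ ‖a‖ ^ k.natAbs * ∑' N, rogersBound q a (V * β) N ^ 2 := by
  have hV : 0 ≤ V := (norm_nonneg v).trans hv
  rw [sectorSum, norm_mul, norm_pow]
  gcongr
  exact tsum_of_norm_bounded (summable_rogersBound_sq hq a (by positivity) hVβ).hasSum
    fun N => norm_rogers_sq_le hq hβ hβ0 hv hv' k.natAbs N

theorem summable_sectorSum {q a b v : ℂ} {V β : ℝ} (hq : ‖q‖ < 1) (ha : ‖a‖ < 1)
    (hβ : β ^ 2 = ‖b‖) (hβ0 : 0 ≤ β) (hVβ : V * β < 1) (hv : ‖v‖ ≤ V) (hv' : ‖v⁻¹‖ ≤ V) :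
    Summable fun k : ℤ => sectorSum q a b k v :=
  Summable.of_norm_bounded ((summable_pow_natAbs (norm_nonneg a) ha).mul_right _)
    (norm_sectorSum_le hq hβ hβ0 hVβ hv hv')

theorem continuousOn_tsum_sectorSum {q a b : ℂ} {V β : ℝ} (hq : ‖q‖ < 1) (ha : ‖a‖ < 1)
    (hβ : β ^ 2 = ‖b‖) (hβ0 : 0 ≤ β) (hV : 0 ≤ V) (hVβ : V * β < 1) :
    ContinuousOn (fun v => ∑' k : ℤ, sectorSum q a b k v) {v | v ≠ 0 ∧ ‖v‖ ≤ V ∧ ‖v⁻¹‖ ≤ V} := by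
  refine continuousOn_tsum (fun k => ?_)
    ((summable_pow_natAbs (norm_nonneg a) ha).mul_right _)
    fun k v hv => norm_sectorSum_le hq hβ hβ0 hVβ hv.2.1 hv.2.2 k
  refine continuousOn_const.mul (continuousOn_tsum (fun N => ?_)
    (summable_rogersBound_sq hq a (t := V * β) (by positivity) hVβ)
    fun N v hv => norm_rogers_sq_le hq hβ hβ0 hv.2.1 hv.2.2 k.natAbs N)
  have h1 : ContinuousOn (fun v : ℂ => v⁻¹) {v | v ≠ 0 ∧ ‖v‖ ≤ V ∧ ‖v⁻¹‖ ≤ V} :=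
    continuousOn_inv₀.mono fun v hv => hv.1
  unfold rogers
  fun_prop

theorem tsum_sectorSum_eq {q a b v : ℂ} (hq0 : q ≠ 0) (hq : ‖q‖ < 1) (ha : ‖a‖ < 1) (hb : ‖b‖ < 1)
    (hab : a * b = q) (hv0 : v ≠ 0) (hv1 : v ^ 2 ≠ 1) (hbv : ‖b * v ^ 2‖ < 1)
    (hbv' : ‖b * (v ^ 2)⁻¹‖ < 1) (hqv : ‖q * v ^ 2‖ < 1) (hqv' : ‖q * (v ^ 2)⁻¹‖ < 1) :
    ∑' k : ℤ, sectorSum q a b k v =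
      blockFactor q a b (v ^ 2) * (∑' j, blockTerm q a b (v ^ 2) j) ^ 2 +
        blockFactor q a b (v ^ 2)⁻¹ * (∑' j, blockTerm q a b (v ^ 2)⁻¹ j) ^ 2 := by
  have h1 := (hasSum_int_mul_natAbs (summable_norm_blockTerm hq ha hbv)).mul_left
    (blockFactor q a b (v ^ 2))
  have h2 := (hasSum_int_mul_natAbs (summable_norm_blockTerm hq ha hbv')).mul_left
    (blockFactor q a b (v ^ 2)⁻¹)
  rw [← (h1.add h2).tsum_eq]
  refine tsum_congr fun k => ?_
  rw [sectorSum, ← tsum_mul_left]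
  exact (hasSum_rogers_sq hq0 hq ha hb hab hv0 hv1 hbv hbv' hqv hqv' k.natAbs).tsum_eq

theorem qPoch2_mul_tsum_sectorSum_of_ne {q a b v : ℂ} (hq0 : q ≠ 0) (hq : ‖q‖ < 1) (ha : ‖a‖ < 1)
    (hb : ‖b‖ < 1) (hab : a * b = q) (hv0 : v ≠ 0) (hv1 : v ^ 2 ≠ 1)
    (hav : ‖a * v ^ 2‖ < 1) (hav' : ‖a * (v ^ 2)⁻¹‖ < 1) (hbv : ‖b * v ^ 2‖ < 1)
    (hbv' : ‖b * (v ^ 2)⁻¹‖ < 1) :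
    qPoch2 b v q * ∑' k : ℤ, sectorSum q a b k v =
      qPoch2 a v q * ∑' k : ℤ, sectorSum q b a k v := by
  have hmul : ∀ {y : ℂ}, ‖b * y‖ < 1 → ‖q * y‖ < 1 := fun {y} h => by
    rw [← hab, mul_assoc, norm_mul]
    exact mul_lt_one_of_nonneg_of_lt_one_left (norm_nonneg _) ha h.le
  have hba : b * a = q := by rw [mul_comm, hab]
  rw [tsum_sectorSum_eq hq0 hq ha hb hab hv0 hv1 hbv hbv' (hmul hbv) (hmul hbv'),
    tsum_sectorSum_eq hq0 hq hb ha hba hv0 hv1 hav hav' (hmul hbv) (hmul hbv'), qPoch2, qPoch2]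
  have h1 := qPoch_mul_qPoch_mul_blockFactor_symm hq ha hb hab hav hbv
  have h2 := qPoch_mul_qPoch_mul_blockFactor_symm hq ha hb hab hav' hbv'
  rw [inv_inv] at h2
  linear_combination h1 + h2

theorem eventually_mul_sqrt_norm_lt_one {x : ℂ} (hx : ‖x‖ < 1) :
    ∀ᶠ V : ℝ in 𝓝[>] 1, V * √‖x‖ < 1 := by
  have h1 : Tendsto (fun V : ℝ => V * √‖x‖) (𝓝[>] 1) (𝓝 (1 * √‖x‖)) :=
    (tendsto_id.mul_const _).mono_left nhdsWithin_le_nhds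
  refine h1.eventually_lt_const ?_
  rw [one_mul, Real.sqrt_lt' one_pos]
  simpa

/-- By the `q`-binomial theorem with `a = 0`, the reciprocal `1 / (y; q)_∞` is a power series on the
disc. -/
theorem continuousAt_qPoch {q x : ℂ} (hq : ‖q‖ < 1) (hx : ‖x‖ < 1) :
    ContinuousAt (fun y => qPoch y q) x := by
  have h1 : ∀ {y : ℂ}, ‖y‖ < 1 → ∑' n, qCoeff q 0 n * y ^ n = (qPoch y q)⁻¹ := fun hy => by
    have h0 : qPoch 0 q = 1 := by simp [qPoch]
    rw [tsum_qCoeff_mul_pow hq 0 hy, qRatio, zero_mul, h0, one_div]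
  have h2 := (continuousAt_tsum_qCoeff hq 0 hx).inv₀
    (by rw [h1 hx]; exact inv_ne_zero (qPoch_ne_zero_of_norm_lt_one hq hx))
  refine h2.congr ?_
  have h3 : ∀ᶠ y in 𝓝 x, ‖y‖ < 1 := continuous_norm.continuousAt.eventually_lt_const hx
  filter_upwards [h3] with y hy
  simp [h1 hy]

theorem continuousAt_qPoch2 {q x v : ℂ} (hq : ‖q‖ < 1) (hv0 : v ≠ 0) (h1 : ‖x * v ^ 2‖ < 1)
    (h2 : ‖x * (v ^ 2)⁻¹‖ < 1) : ContinuousAt (fun v => qPoch2 x v q) v := by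
  have h3 : ContinuousAt (fun v : ℂ => x * v ^ 2) v := by fun_prop
  have h4 : ContinuousAt (fun v : ℂ => x * (v ^ 2)⁻¹) v :=
    continuousAt_const.mul ((continuousAt_id.pow 2).inv₀ (pow_ne_zero 2 hv0))
  exact (ContinuousAt.comp (f := fun v : ℂ => x * v ^ 2) (continuousAt_qPoch hq h1) h3).mul
    (ContinuousAt.comp (f := fun v : ℂ => x * (v ^ 2)⁻¹) (continuousAt_qPoch hq h2) h4)

theorem continuousAt_tsum_sectorSum {q a b v : ℂ} (hq : ‖q‖ < 1) (ha : ‖a‖ < 1) (hb : ‖b‖ < 1)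
    (hv : v ^ 2 = 1) : ContinuousAt (fun v => ∑' k : ℤ, sectorSum q a b k v) v := by
  have hvn : ‖v‖ = 1 := by
    have h : ‖v‖ ^ 2 = 1 := by rw [← norm_pow, hv, norm_one]
    exact (pow_eq_one_iff_of_nonneg (norm_nonneg _) two_ne_zero).mp h
  have hv0 : v ≠ 0 := by rintro rfl; simp at hvn
  obtain ⟨V, hV, hV1⟩ := ((eventually_mul_sqrt_norm_lt_one hb).and self_mem_nhdsWithin).exists
  have hV1 : 1 < V := hV1
  refine (continuousOn_tsum_sectorSum hq ha (Real.sq_sqrt (norm_nonneg b)) (Real.sqrt_nonneg _)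
    (zero_le_one.trans hV1.le) hV).continuousAt ?_
  have h1 : ∀ᶠ w in 𝓝 v, ‖w‖ < V :=
    continuous_norm.continuousAt.eventually_lt_const (by simpa [hvn] using hV1)
  have h2 : ∀ᶠ w in 𝓝 v, ‖w⁻¹‖ < V :=
    (continuousAt_inv₀ hv0).norm.eventually_lt_const (by simpa [hvn] using hV1)
  filter_upwards [h1, h2, isOpen_ne.mem_nhds hv0] with w h1 h2 h3
  exact ⟨h3, h1.le, h2.le⟩

theorem qPoch2_mul_tsum_sectorSum {q a b v : ℂ} (hq0 : q ≠ 0) (hq : ‖q‖ < 1) (ha : ‖a‖ < 1)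
    (hb : ‖b‖ < 1) (hab : a * b = q) (hv0 : v ≠ 0)
    (hav : ‖a * v ^ 2‖ < 1) (hav' : ‖a * (v ^ 2)⁻¹‖ < 1) (hbv : ‖b * v ^ 2‖ < 1)
    (hbv' : ‖b * (v ^ 2)⁻¹‖ < 1) :
    qPoch2 b v q * ∑' k : ℤ, sectorSum q a b k v =
      qPoch2 a v q * ∑' k : ℤ, sectorSum q b a k v := by
  by_cases hv1 : v ^ 2 = 1
  swap
  · exact qPoch2_mul_tsum_sectorSum_of_ne hq0 hq ha hb hab hv0 hv1 hav hav' hbv hbv'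
  have hvinv : (v ^ 2)⁻¹ = 1 := by rw [hv1, inv_one]
  have hL : ContinuousAt (fun v => qPoch2 b v q * ∑' k : ℤ, sectorSum q a b k v) v :=
    (continuousAt_qPoch2 hq hv0 hbv hbv').mul (continuousAt_tsum_sectorSum hq ha hb hv1)
  have hR : ContinuousAt (fun v => qPoch2 a v q * ∑' k : ℤ, sectorSum q b a k v) v :=
    (continuousAt_qPoch2 hq hv0 hav hav').mul (continuousAt_tsum_sectorSum hq hb ha hv1)
  refine tendsto_nhds_unique_of_eventuallyEq (l := 𝓝[≠] v)
    (hL.tendsto.mono_left nhdsWithin_le_nhds) (hR.tendsto.mono_left nhdsWithin_le_nhds) ?_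
  have hc : ∀ {x : ℂ}, ‖x‖ < 1 → ∀ᶠ w in 𝓝 v, ‖x * w ^ 2‖ < 1 ∧ ‖x * (w ^ 2)⁻¹‖ < 1 := by
    intro x hx
    have h3 : ContinuousAt (fun v : ℂ => x * v ^ 2) v := by fun_prop
    have h4 : ContinuousAt (fun v : ℂ => x * (v ^ 2)⁻¹) v :=
      continuousAt_const.mul ((continuousAt_id.pow 2).inv₀ (pow_ne_zero 2 hv0))
    exact (h3.norm.eventually_lt_const (by simpa [hv1] using hx)).and
      (h4.norm.eventually_lt_const (by simpa [hvinv] using hx))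
  -- A nearby `w` must avoid both roots `v` and `-v` of `w² = 1`.
  have hneg : v ≠ -v := fun h => hv0 (self_eq_neg.mp h)
  filter_upwards [nhdsWithin_le_nhds (hc ha), nhdsWithin_le_nhds (hc hb), self_mem_nhdsWithin,
    nhdsWithin_le_nhds (isOpen_ne.mem_nhds hv0), nhdsWithin_le_nhds (isOpen_ne.mem_nhds hneg)]
    with w h1 h2 h3 h4 h5
  refine qPoch2_mul_tsum_sectorSum_of_ne hq0 hq ha hb hab h4 (fun h => ?_) h1.1 h1.2 h2.1 h2.2
  rw [← hv1, sq_eq_sq_iff_eq_or_eq_neg] at h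
  exact h.elim h3 h5

/-! ### Constant terms by integration over the unit circle. -/

theorem hasSum_circleIntegral_of_summable {ι : Type*} [Countable ι] {F : ι → ℂ → ℂ} {u : ι → ℝ}
    {G : ℂ → ℂ} (hF : ∀ i, ContinuousOn (F i) (Metric.sphere 0 1)) (hu : Summable u)
    (hFu : ∀ i, ∀ z ∈ Metric.sphere (0 : ℂ) 1, ‖F i z‖ ≤ u i)
    (hG : ∀ z ∈ Metric.sphere (0 : ℂ) 1, HasSum (fun i => F i z) (G z)) :
    HasSum (fun i => ∮ z in C(0, 1), F i z) (∮ z in C(0, 1), G z) := by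
  have hm : ∀ θ, circleMap (0 : ℂ) 1 θ ∈ Metric.sphere (0 : ℂ) 1 := fun θ =>
    circleMap_mem_sphere _ zero_le_one _
  refine intervalIntegral.hasSum_integral_of_dominated_convergence (fun i _ => u i)
    (fun i => ?_) (fun i => ?_) ?_ ?_ ?_
  · refine Continuous.aestronglyMeasurable ?_
    have h1 : Continuous fun θ => F i (circleMap 0 1 θ) :=
      (hF i).comp_continuous (continuous_circleMap 0 1) hm
    have h2 := continuous_circleMap 0 1
    simp only [deriv_circleMap]
    exact (h2.mul continuous_const).smul h1
  · refine Eventually.of_forall fun θ _ => ?_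
    simpa using hFu i _ (hm θ)
  · exact Eventually.of_forall fun θ _ => hu
  · exact intervalIntegrable_const
  · exact Eventually.of_forall fun θ _ => (hG _ (hm θ)).const_smul _

theorem circleIntegral_zpow (n : ℤ) :
    (∮ z in C(0, 1), z ^ n) = if n = -1 then 2 * (π : ℂ) * Complex.I else 0 := by
  split_ifs with h
  · have := circleIntegral.integral_sub_center_inv (0 : ℂ) (R := 1) one_ne_zero
    simpa [h] using this
  · simpa using circleIntegral.integral_sub_zpow_of_ne h 0 0 1

section

variable {A B : ℕ → ℂ}

theorem continuousOn_tsum_mul_tsum_inv (hA : Summable fun n => ‖A n‖)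
    (hB : Summable fun n => ‖B n‖) :
    ContinuousOn (fun z : ℂ => (∑' n, A n * z ^ n) * ∑' n, B n * z⁻¹ ^ n)
      (Metric.sphere 0 1) := by
  have hinv : ContinuousOn (fun z : ℂ => z⁻¹) (Metric.sphere 0 1) :=
    continuousOn_inv₀.mono fun z hz => by
      rintro rfl
      simp at hz
  refine (continuousOn_tsum (fun n => by fun_prop) hA fun n z hz => ?_).mul
    (continuousOn_tsum (fun n => by fun_prop) hB fun n z hz => ?_) <;>
  · have : ‖z‖ = 1 := by simpa using hz
    simp [this]

/-- The constant term of the product of a power series in `z` and a power series in `z⁻¹`. -/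
theorem torusIntegral1_tsum_mul_tsum_inv (hA : Summable fun n => ‖A n‖)
    (hB : Summable fun n => ‖B n‖) :
    torusIntegral1 (fun z => (∑' n, A n * z ^ n) * ∑' n, B n * z⁻¹ ^ n) = ∑' n, A n * B n := by
  have hz0 : ∀ z ∈ Metric.sphere (0 : ℂ) 1, z ≠ 0 := by
    rintro z hz rfl
    simp at hz
  have hAB : Summable fun p : ℕ × ℕ => ‖A p.1 * B p.2‖ := hA.mul_norm hB
  -- The `-1` in the exponent is the `1 / z` of the measure, so only the diagonal `p.1 = p.2` has a
  -- nonzero integral.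
  have H := hasSum_circleIntegral_of_summable
    (F := fun (p : ℕ × ℕ) z => A p.1 * B p.2 * z ^ ((p.1 : ℤ) - p.2 - 1))
    (G := fun z => (∑' n, A n * z ^ n) * (∑' n, B n * z⁻¹ ^ n) / z)
    (u := fun p => ‖A p.1 * B p.2‖)
    (fun p => continuousOn_const.mul fun z hz =>
      (continuousAt_zpow₀ z _ (Or.inl (hz0 z hz))).continuousWithinAt) hAB
    (fun p z hz => by
      have : ‖z‖ = 1 := by simpa using hz
      simp [norm_zpow, this])
    (fun z hz => by
      have h1 : ‖z‖ = 1 := by simpa using hz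
      have hA' : Summable fun n => ‖A n * z ^ n‖ := by simpa [h1] using hA
      have hB' : Summable fun n => ‖B n * z⁻¹ ^ n‖ := by simpa [h1] using hB
      rw [tsum_mul_tsum_of_summable_norm hA' hB']
      convert! (summable_mul_of_summable_norm hA' hB').hasSum.div_const z using 2 with p
      rw [zpow_sub₀ (hz0 z hz), zpow_sub₀ (hz0 z hz), zpow_natCast, zpow_natCast, zpow_one, inv_pow]
      ring)
  simp only [circleIntegral.integral_const_mul, circleIntegral_zpow] at H
  rw [torusIntegral1, ← H.tsum_eq, H.summable.tsum_prod, ← tsum_mul_left]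
  refine tsum_congr fun n => ?_
  rw [tsum_eq_single n fun m hm => by
    rw [if_neg (by intro h; apply hm; push_cast at h; omega), mul_zero]]
  have : (2 * (π : ℂ) * Complex.I) ≠ 0 := Complex.two_pi_I_ne_zero
  rw [if_pos (by simp)]
  field_simp

end

/-! ### The two indices as sector sums. -/

theorem norm_lt_one_of_sq {x y : ℂ} (h : x ^ 2 = y) (hy : ‖y‖ < 1) : ‖x‖ < 1 := by
  rw [← h, norm_pow] at hy
  exact (pow_lt_one_iff_of_nonneg (norm_nonneg _) two_ne_zero).mp hy

theorem qPoch4_ne_zero {q τ v z : ℂ} (hq : ‖q‖ < 1) (h1 : ‖v * τ‖ < 1) (h2 : ‖v⁻¹ * τ‖ < 1)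
    (hz : ‖z‖ = 1) : qPoch4 τ v z q ≠ 0 := by
  have h : ∀ {u w : ℂ}, ‖u * τ‖ < 1 → ‖w‖ = 1 → qPoch (τ * u * w) q ≠ 0 := fun {u w} hu hw =>
    qPoch_ne_zero_of_norm_lt_one hq (by rwa [norm_mul, hw, mul_one, mul_comm])
  have hz' : ‖z⁻¹‖ = 1 := by rw [norm_inv, hz, inv_one]
  exact mul_ne_zero (mul_ne_zero (mul_ne_zero (h h1 hz) (h h1 hz')) (h h2 hz)) (h h2 hz')

/-- The two factors with `z` form the Rogers generating function at `τ z`, the two with `z⁻¹` the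
one at `τ z⁻¹`. -/
theorem qPoch4_div_qPoch4 {q a τ v z : ℂ} (hq : ‖q‖ < 1) (h1 : ‖v * τ‖ < 1) (h2 : ‖v⁻¹ * τ‖ < 1)
    (hz : ‖z‖ = 1) : qPoch4 (a * τ) v z q / qPoch4 τ v z q =
      (∑' N, rogers q a v N * τ ^ N * z ^ N) * ∑' N, rogers q a v N * τ ^ N * z⁻¹ ^ N := by
  have h : ∀ {w : ℂ}, ‖w‖ = 1 → ∑' N, rogers q a v N * τ ^ N * w ^ N =
      qRatio q a (τ * v * w) * qRatio q a (τ * v⁻¹ * w) := by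
    intro w hw
    have hb : ∀ {u : ℂ}, ‖u * τ‖ < 1 → ‖u * (τ * w)‖ < 1 := fun hu => by
      rwa [← mul_assoc, norm_mul, hw, mul_one]
    rw [show τ * v * w = v * (τ * w) by ring, show τ * v⁻¹ * w = v⁻¹ * (τ * w) by ring,
      ← tsum_rogers hq (hb h1) (hb h2)]
    exact tsum_congr fun N => by rw [mul_pow]; ring
  rw [h hz, h (by rw [norm_inv, hz, inv_one])]
  simp only [qPoch4, qRatio, ← mul_assoc]
  simp only [div_eq_mul_inv, mul_inv]
  ring

section

variable {q a b r s v : ℂ}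

theorem norm_mul_sqrt_mul_pow_lt_one (hq : ‖q‖ < 1) (hr : r ^ 2 = q) {u t : ℂ}
    (hut : ‖u ^ 2 * t ^ 2‖ < 1) (n : ℕ) : ‖u * (t * r ^ n)‖ < 1 :=
  norm_lt_one_of_sq (y := u ^ 2 * t ^ 2 * q ^ n) (by rw [← hr]; ring)
    (norm_mul_pow_lt_one hq hut n)

theorem electricIntegrand_eq (hq : ‖q‖ < 1) (hs0 : s ≠ 0) (hs : s ^ 2 = a)
    (k : ℤ) {z : ℂ} (hz : ‖z‖ = 1) (h1 : ‖v * (s⁻¹ * r ^ (1 + k.natAbs))‖ < 1)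
    (h2 : ‖v⁻¹ * (s⁻¹ * r ^ (1 + k.natAbs))‖ < 1) :
    electricIntegrand q r s v k z =
      (∑' N, rogers q a v N * (s⁻¹ * r ^ (1 + k.natAbs)) ^ N * z ^ N) *
        ∑' N, rogers q a v N * (s⁻¹ * r ^ (1 + k.natAbs)) ^ N * z⁻¹ ^ N := by
  rw [← qPoch4_div_qPoch4 hq h1 h2 hz, electricIntegrand,
    show a * (s⁻¹ * r ^ (1 + k.natAbs)) = s * r ^ (1 + k.natAbs) by rw [← hs]; field_simp]

theorem circleIntegrable_electricIntegrand (hq : ‖q‖ < 1) (hs0 : s ≠ 0) (hs : s ^ 2 = a)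
    (k : ℤ) (h1 : ‖v * (s⁻¹ * r ^ (1 + k.natAbs))‖ < 1)
    (h2 : ‖v⁻¹ * (s⁻¹ * r ^ (1 + k.natAbs))‖ < 1) :
    CircleIntegrable (fun z => electricIntegrand q r s v k z / z) 0 1 := by
  have hsum := summable_norm_rogers (a := a) hq h1 h2
  refine ContinuousOn.circleIntegrable zero_le_one (ContinuousOn.div ?_ continuousOn_id ?_)
  · refine (continuousOn_tsum_mul_tsum_inv hsum hsum).congr fun z hz => ?_
    exact electricIntegrand_eq hq hs0 hs k (by simpa using hz) h1 h2
  · rintro z hz rfl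
    simp at hz

/-- The constant term involves only `τ² = b q^|k|`, so the chosen square roots drop out. -/
theorem electricTerm_eq_sectorSum (hq : ‖q‖ < 1) (ha0 : a ≠ 0) (hab : a * b = q) (hs0 : s ≠ 0)
    (hr : r ^ 2 = q) (hs : s ^ 2 = a)
    (k : ℤ) (h1 : ‖v * (s⁻¹ * r ^ (1 + k.natAbs))‖ < 1)
    (h2 : ‖v⁻¹ * (s⁻¹ * r ^ (1 + k.natAbs))‖ < 1) :
    electricTerm q a r s v k = sectorSum q a b k v := by
  have hsum := summable_norm_rogers (a := a) hq h1 h2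
  have h3 := torusIntegral1_tsum_mul_tsum_inv hsum hsum
  have hτ : (s⁻¹ * r ^ (1 + k.natAbs)) ^ 2 = b * q ^ k.natAbs := by
    have hb : b = q / a := by rw [← hab]; field_simp
    rw [hb, ← hs, ← hr]
    ring
  rw [electricTerm, sectorSum]
  congr 1
  calc _ = _ := by
        refine congrArg (fun w => (2 * (π : ℂ) * Complex.I)⁻¹ * w)
          (circleIntegral.integral_congr zero_le_one fun z hz => ?_)
        simp only [electricIntegrand_eq hq hs0 hs k (by simpa using hz) h1 h2]
    _ = _ := h3
    _ = _ := tsum_congr fun N => by rw [← hτ]; ring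

theorem exists_bound_mul_sqrt_lt_one (hbv : ‖b * v ^ 2‖ < 1) (hbv' : ‖b * (v ^ 2)⁻¹‖ < 1) :
    max ‖v‖ ‖v⁻¹‖ * √‖b‖ < 1 := by
  have h : ∀ {w : ℂ}, ‖b * w ^ 2‖ < 1 → ‖w‖ * √‖b‖ < 1 := fun {w} hw => by
    refine (pow_lt_one_iff_of_nonneg (by positivity) two_ne_zero).mp ?_
    rwa [mul_pow, Real.sq_sqrt (norm_nonneg _), ← norm_pow, ← norm_mul, mul_comm]
  rcases max_choice ‖v‖ ‖v⁻¹‖ with e | e <;> rw [e]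
  · exact h hbv
  · exact h (by rwa [inv_pow])

theorem norm_lt_one_of_norm_mul_lt_one (hv0 : v ≠ 0) (h1 : ‖a * v ^ 2‖ < 1)
    (h2 : ‖a * (v ^ 2)⁻¹‖ < 1) : ‖a‖ < 1 := by
  refine norm_lt_one_of_sq (y := a * v ^ 2 * (a * (v ^ 2)⁻¹)) (by field_simp) ?_
  rw [norm_mul]
  exact mul_lt_one_of_nonneg_of_lt_one_left (norm_nonneg _) h1 h2.le

/-- The mirror theory is the electric one at `q / a`, for which `r / s` is a square root. -/
theorem mirrorIntegrand_eq (hs0 : s ≠ 0) (hr0 : r ≠ 0) :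
    mirrorIntegrand q r s v = electricIntegrand q r (r / s) v := by
  funext k z
  rw [mirrorIntegrand, electricIntegrand,
    show s⁻¹ * r ^ (2 + k.natAbs) = r / s * r ^ (1 + k.natAbs) by ring,
    show s * r ^ k.natAbs = (r / s)⁻¹ * r ^ (1 + k.natAbs) by rw [pow_add]; field_simp]

theorem mirrorTerm_eq (hs0 : s ≠ 0) (hr0 : r ≠ 0) :
    mirrorTerm q a r s v = electricTerm q (q / a) r (r / s) v := by
  funext k
  rw [mirrorTerm, electricTerm, mirrorIntegrand_eq hs0 hr0]

end

end

theorem theorem3 (q a v r s : ℂ)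
    (hq0 : q ≠ 0) (hq1 : ‖q‖ < 1) (ha0 : a ≠ 0) (hv0 : v ≠ 0)
    -- `r` and `s` are arbitrary choices of the square roots of `q` and `a`
    (hr : r ^ 2 = q) (hs : s ^ 2 = a)
    -- the unit circle separates the poles converging to zero from their reciprocals
    (hav : ‖a * v ^ 2‖ < 1) (hav' : ‖a * (v ^ 2)⁻¹‖ < 1)
    (hqav : ‖q / a * v ^ 2‖ < 1) (hqav' : ‖q / a * (v ^ 2)⁻¹‖ < 1) :
    -- the integrands have no singularity on the unit circle and all integrals exist
    (∀ (k : ℤ) (z : ℂ), ‖z‖ = 1 →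
      qPoch4 (s⁻¹ * r ^ (1 + k.natAbs)) v z q ≠ 0 ∧ qPoch4 (s * r ^ k.natAbs) v z q ≠ 0) ∧
    (∀ k : ℤ, CircleIntegrable (fun z => electricIntegrand q r s v k z / z) 0 1) ∧
    (∀ k : ℤ, CircleIntegrable (fun z => mirrorIntegrand q r s v k z / z) 0 1) ∧
    -- the prefactor of the mirror index is defined and both series converge
    qPoch2 (q / a) v q ≠ 0 ∧
    Summable (electricTerm q a r s v) ∧
    Summable (mirrorTerm q a r s v) ∧
    electricIndex q a r s v = mirrorIndex q a r s v := by
  have hr0 : r ≠ 0 := by rintro rfl; simp at hr; exact hq0 hr.symm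
  have hs0 : s ≠ 0 := by rintro rfl; simp at hs; exact ha0 hs.symm
  have hb0 : q / a ≠ 0 := div_ne_zero hq0 ha0
  have hab : a * (q / a) = q := by field_simp
  have hba : q / a * a = q := by field_simp
  have hrs : (r / s) ^ 2 = q / a := by rw [div_pow, hr, hs]
  have ha := norm_lt_one_of_norm_mul_lt_one hv0 hav hav'
  have hb := norm_lt_one_of_norm_mul_lt_one hv0 hqav hqav'
  -- The square of the quantity is `b u² q^n`. General `a`, `b`, `s` allow use for both `(a, q / a,
  -- s)` and `(q / a, a, r / s)`.
  have he : ∀ {a b s u : ℂ}, s ^ 2 = a → s ≠ 0 → a * b = q → ‖b * u ^ 2‖ < 1 → ∀ n : ℕ,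
      ‖u * (s⁻¹ * r ^ (1 + n))‖ < 1 := by
    intro a b s u hs hs0 hab hbu n
    rw [pow_add, pow_one, ← mul_assoc s⁻¹]
    refine norm_mul_sqrt_mul_pow_lt_one hq1 hr ?_ n
    rwa [mul_pow, hr, ← hab, ← hs, show u ^ 2 * (s⁻¹ ^ 2 * (s ^ 2 * b)) = b * u ^ 2 by field_simp]
  have he1 := fun k : ℤ => he hs hs0 hab hqav k.natAbs
  have he2 := fun k : ℤ => he (u := v⁻¹) hs hs0 hab (by rwa [inv_pow]) k.natAbs
  have hm1 := fun k : ℤ => he hrs (div_ne_zero hr0 hs0) hba hav k.natAbs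
  have hm2 := fun k : ℤ => he (u := v⁻¹) hrs (div_ne_zero hr0 hs0) hba (by rwa [inv_pow]) k.natAbs
  have hE : electricTerm q a r s v = fun k => sectorSum q a (q / a) k v := funext fun k =>
    electricTerm_eq_sectorSum hq1 ha0 hab hs0 hr hs k (he1 k) (he2 k)
  have hM : mirrorTerm q a r s v = fun k => sectorSum q (q / a) a k v := by
    rw [mirrorTerm_eq hs0 hr0]
    exact funext fun k => electricTerm_eq_sectorSum hq1 hb0 hba (div_ne_zero hr0 hs0) hr hrs k
      (hm1 k) (hm2 k)
  have hP : qPoch2 (q / a) v q ≠ 0 := mul_ne_zero (qPoch_ne_zero_of_norm_lt_one hq1 hqav)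
    (qPoch_ne_zero_of_norm_lt_one hq1 hqav')
  refine ⟨fun k z hz => ⟨qPoch4_ne_zero hq1 (he1 k) (he2 k) hz, ?_⟩,
    fun k => circleIntegrable_electricIntegrand hq1 hs0 hs k (he1 k) (he2 k), fun k => ?_, hP,
    ?_, ?_, ?_⟩
  · rw [show s * r ^ k.natAbs = (r / s)⁻¹ * r ^ (1 + k.natAbs) by rw [pow_add]; field_simp]
    exact qPoch4_ne_zero hq1 (hm1 k) (hm2 k) hz
  · rw [mirrorIntegrand_eq hs0 hr0]
    exact circleIntegrable_electricIntegrand hq1 (div_ne_zero hr0 hs0) hrs k (hm1 k) (hm2 k)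
  · rw [hE]
    exact summable_sectorSum hq1 ha (Real.sq_sqrt (norm_nonneg _)) (Real.sqrt_nonneg _)
      (exists_bound_mul_sqrt_lt_one hqav hqav') (le_max_left _ _) (le_max_right _ _)
  · rw [hM]
    exact summable_sectorSum hq1 hb (Real.sq_sqrt (norm_nonneg _)) (Real.sqrt_nonneg _)
      (exists_bound_mul_sqrt_lt_one hav hav') (le_max_left _ _) (le_max_right _ _)
  · rw [electricIndex, mirrorIndex, hE, hM, div_mul_eq_mul_div, eq_div_iff hP, mul_comm]
    exact qPoch2_mul_tsum_sectorSum hq0 hq1 ha hb hab hv0 hav hav' hqav hqav'
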